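/- Let $m,n,k$ be positive integers with $k<\min\{m,n\}$, let $\mathbb{R}^{m\times n}$ carry the Frobenius inner product $\langle A,B\rangle_{\mathrm F}=\operatorname{tr}(A^\top B)$ with norm $\|\cdot\|=\|\cdot\|_{\mathrm F}$, and let $\mathcal M_k=\{X\in\mathbb{R}^{m\times n}:\operatorname{rank}X=k\}$, an embedded Riemannian submanifold of $\mathbb{R}^{m\times n}$. Let $f:\mathbb{R}^{m\times n}\to\mathbb{R}$ be differentiable, $\lambda$-smooth (that is, $\|\nabla f(X)-\nabla f(Y)\|\le\lambda\|X-Y\|$ for all $X,Y$) and strongly convex (that is, for some $\mu>0$, $f(Y)\ge f(X)+\langle\nabla f(X),Y-X\rangle_{\mathrm F}+\frac{\mu}{2}\|Y-X\|^2$ for all $X,Y$). Let $(U_\ell,V_\ell)_{\ell\ge0}$, $U_\ell\in\mathbb{R}^{m\times k}$, $V_\ell\in\mathbb{R}^{n\times k}$, be generated by the alternating least squares (ALS) method from arbitrary $U_0,V_0$: for $\ell=0,1,2,\dots$, (i) let $Q_\ell$ be a QR-factor of $V_\ell$ (a matrix with orthonormal columns such that $V_\ell=Q_\ell R$ with $R\in\mathbb{R}^{k\times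 k}$ upper triangular); (ii) choose $W_{\ell+1}\in\operatorname{argmin}_{U\in\mathbb{R}^{m\times k}}f(UQ_\ell^\top)$; (iii) let $U_{\ell+1}$ be a QR-factor of $W_{\ell+1}$; (iv) choose $V_{\ell+1}\in\operatorname{argmin}_{V\in\mathbb{R}^{n\times k}}f(U_{\ell+1}V^\top)$. Put $X_\ell=U_\ell V_\ell^\top$. Assume that $(X_\ell)$ has an accumulation point $X_*$ of rank $k$ such that $f$ is twice continuously differentiable in a neighborhood of $X_*$ and the Riemannian Hessian $H(X_*)$ of $f|_{\mathcal M_k}$ at $X_*$ is positive definite on the tangent space $T_{X_*}\mathcal M_k$. Here $H(X)[\xi]=P_{X}\big(\mathrm D\operatorname{grad}f(X)[\xi]\big)$ for $\xi\in T_X\mathcal M_k$, where $P_X$ is the orthogonal projection onto $T_X\mathcal M_k$, $\operatorname{grad}f(X)=P_X(\nabla f(X))$ for $X\in\mathcal M_k$, and $\mathrm D$ is the derivative along $\mathcal M_k$. Write $X_*=U_*S_*V_*^\top$ with $U_*^\top U_*=V_*^\top V_*=I_k$ and $S_*\in\mathbb{R}^{k\times k}$, and put $\mathcal P_{V_*}(Z)=ZV_*V_*^\top$,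 $\mathcal P_{U_*}(Z)=U_*U_*^\top Z$. Let $\lambda^*_{\min}$ be the smallest eigenvalue of $H(X_*)$, and let $\lambda^*$ be the maximum of the operator norms (induced by the Frobenius norm) of $\mathcal P_{V_*}\nabla^2f(X_*)\mathcal P_{V_*}$ and $\mathcal P_{U_*}\nabla^2f(X_*)\mathcal P_{U_*}$, where $\nabla^2 f(X_*)$ is the Euclidean Hessian. Then $X_\ell\to X_*$ (so $X_*$ is the unique limit point of $(X_\ell)$); $X_*$ is an isolated local minimizer of $f|_{\mathcal M_k}$, meaning that it is a local minimizer and all other points $X\in\mathcal M_k$ sufficiently close to $X_*$ satisfy $f(X)>f(X_*)$ and are not local minimizers of $f|_{\mathcal M_k}$; $f(X_\ell)\ge f(X_*)$ for all $\ell$; and the convergence is R-linear with $$\limsup_{\ell\to\infty}\|X_\ell-X_*\|^{1/\ell}\le1-\frac{\lambda^*_{\min}}{\lambda^*}<1,\qquad \limsup_{\ell\to\infty}\,[f(X_\ell)-f(X_*)]^{1/\ell}\le\Big(1-\frac{\lambda^*_{\min}}{\lambda^*}\Big)^2 .$$ -/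

import Mathlib

open Filter Topology

-- Matrices carry the Frobenius norm and the Frobenius inner product `⟪A, B⟫ = tr (Aᵀ B)`.
attribute [local instance] Matrix.frobeniusNormedAddCommGroup

namespace LowRank

/-- The topology of the Frobenius norm (it is definitionally the entrywise topology). -/
noncomputable instance frobeniusTopologicalSpace {m n : ℕ} :
    TopologicalSpace (Matrix (Fin m) (Fin n) ℝ) :=
  (Matrix.frobeniusNormedAddCommGroup :
    NormedAddCommGroup (Matrix (Fin m) (Fin n) ℝ)).toMetricSpace.toPseudoMetricSpace.toUniformSpace.toTopologicalSpace

noncomputable instance frobeniusInnerProductSpace {m n : ℕ} :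
    InnerProductSpace ℝ (Matrix (Fin m) (Fin n) ℝ) where
  __ := (Matrix.frobeniusNormedSpace : NormedSpace ℝ (Matrix (Fin m) (Fin n) ℝ))
  inner A B := (A.transpose * B).trace
  norm_sq_eq_re_inner A := by
    have h : ‖A‖ ^ 2 = ∑ i, ∑ j, A i j ^ 2 := by
      rw [Matrix.frobenius_norm_def, ← Real.sqrt_eq_rpow, Real.sq_sqrt]
      · simp
      · positivity
    rw [h, Finset.sum_comm]
    simp [Matrix.trace, Matrix.mul_apply, pow_two]
  conj_inner_symm A B := by
    simp only [conj_trivial]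
    rw [← Matrix.trace_transpose, Matrix.transpose_mul, Matrix.transpose_transpose]
  add_left A B C := by
    simp [Matrix.transpose_add, Matrix.add_mul, Matrix.trace_add]
  smul_left A B r := by
    simp [Matrix.transpose_smul, Matrix.trace_smul]

section Riemannian

variable {E : Type*} [NormedAddCommGroup E] [InnerProductSpace ℝ E] [FiniteDimensional ℝ E]

/-- The tangent space at `x` of an embedded submanifold `M` of a Euclidean space: the linear
subspace spanned by the tangent directions of `M` at `x`. -/
def tangentSpaceAt (M : Set E) (x : E) : Submodule ℝ E :=
  Submodule.span ℝ (tangentConeAt ℝ M x)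

/-- The Riemannian gradient of `f|_M` at `x` for the embedded metric: the orthogonal projection
of the Euclidean gradient onto the tangent space. -/
noncomputable def riemannianGradient (M : Set E) (f : E → ℝ) (x : E) : E :=
  (tangentSpaceAt M x).starProjection (gradient f x)

/-- The Riemannian Hessian of `f|_M` at `x` for the embedded metric: the tangent vector `ξ` is
sent to the orthogonal projection onto the tangent space of the derivative along `M`, in direction
`ξ`, of the Riemannian gradient field. (A derivative within `M` is determined in the directions
tangent to `M`, and only these are used.) -/
noncomputable def riemannianHessian (M : Set E) (f : E → ℝ) (x : E) :
    tangentSpaceAt M x →ₗ[ℝ] tangentSpaceAt M x :=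
  ((tangentSpaceAt M x).orthogonalProjectionOnto ∘L
    fderivWithin ℝ (riemannianGradient M f) M x ∘L (tangentSpaceAt M x).subtypeL).toLinearMap

/-- A linear operator `H` on a space of tangent vectors is positive definite. -/
def IsPosDef {T : Submodule ℝ E} (H : T →ₗ[ℝ] T) : Prop :=
  ∀ ξ : T, ξ ≠ 0 → 0 < inner ℝ (H ξ) ξ

/-- `f` is `lam`-smooth: differentiable with `lam`-Lipschitz gradient. -/
def IsSmooth (lam : ℝ) (f : E → ℝ) : Prop :=
  0 ≤ lam ∧ Differentiable ℝ f ∧ ∀ x y, ‖gradient f x - gradient f y‖ ≤ lam * ‖x - y‖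

/-- `f` (assumed differentiable) is strongly convex. -/
def IsStronglyConvex (f : E → ℝ) : Prop :=
  ∃ μ : ℝ, 0 < μ ∧ ∀ x y,
    f x + inner ℝ (gradient f x) (y - x) + μ / 2 * ‖y - x‖ ^ 2 ≤ f y

/-- The Euclidean Hessian, as a linear operator. -/
noncomputable def euclideanHessian (f : E → ℝ) (x : E) : E →L[ℝ] E :=
  fderiv ℝ (gradient f) x

/-- `x` is an isolated local minimizer of `f|_S`: it is a local minimizer, and all other points of
`S` near `x` have a strictly larger function value and are not local minimizers of `f|_S`. -/
def IsIsolatedLocalMinOn (f : E → ℝ) (S : Set E) (x : E) : Prop :=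
  x ∈ S ∧ IsLocalMinOn f S x ∧
    ∀ᶠ y in 𝓝[S \ {x}] x, f x < f y ∧ ¬ IsLocalMinOn f S y

end Riemannian

/-- The manifold of `m × n` matrices of rank exactly `k`. -/
def fixedRank (m n k : ℕ) : Set (Matrix (Fin m) (Fin n) ℝ) := {X | X.rank = k}

/-- `Z ↦ Z V Vᵀ`; for `V` with orthonormal columns, the orthogonal projection onto
`{L Vᵀ : L ∈ ℝ^{m × k}}`. -/
noncomputable def projV {n k : ℕ} (m : ℕ) (V : Matrix (Fin n) (Fin k) ℝ) :
    Matrix (Fin m) (Fin n) ℝ →L[ℝ] Matrix (Fin m) (Fin n) ℝ :=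
  LinearMap.toContinuousLinearMap
    { toFun := fun Z => Z * (V * V.transpose)
      map_add' := fun Z W => Matrix.add_mul Z W _
      map_smul' := fun c Z => Matrix.smul_mul c Z _ }

/-- `Z ↦ U Uᵀ Z`; for `U` with orthonormal columns, the orthogonal projection onto
`{U Rᵀ : R ∈ ℝ^{n × k}}`. -/
noncomputable def projU {m k : ℕ} (n : ℕ) (U : Matrix (Fin m) (Fin k) ℝ) :
    Matrix (Fin m) (Fin n) ℝ →L[ℝ] Matrix (Fin m) (Fin n) ℝ :=
  LinearMap.toContinuousLinearMap
    { toFun := fun Z => (U * U.transpose) * Z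
      map_add' := fun Z W => Matrix.mul_add _ Z W
      map_smul' := fun c Z => Matrix.mul_smul _ c Z }

/-- The maximum of the operator norms (induced by the Frobenius norm) of the two projected
Euclidean Hessians `P_V ∇²f(X) P_V` and `P_U ∇²f(X) P_U`. -/
noncomputable def projectedHessianNorm {m n k : ℕ} (f : Matrix (Fin m) (Fin n) ℝ → ℝ)
    (U : Matrix (Fin m) (Fin k) ℝ) (V : Matrix (Fin n) (Fin k) ℝ)
    (X : Matrix (Fin m) (Fin n) ℝ) : ℝ :=
  max ‖projV m V ∘L euclideanHessian f X ∘L projV m V‖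
    ‖projU n U ∘L euclideanHessian f X ∘L projU n U‖

/-- `Q` is a QR-factor of `Y`: it has orthonormal columns and `Y = Q R` with `R` upper triangular.
(It need not be unique.) -/
def IsQRFactor {p k : ℕ} (Y Q : Matrix (Fin p) (Fin k) ℝ) : Prop :=
  Q.transpose * Q = 1 ∧ ∃ R : Matrix (Fin k) (Fin k) ℝ, R.BlockTriangular id ∧ Y = Q * R

/-- `(U ℓ, V ℓ)` are iterates of the alternating least squares method for `f`, started from
arbitrary `U 0`, `V 0`. In step `ℓ`, a QR-factor `Q` of `V ℓ` is taken, `U ↦ f (U Qᵀ)` is globally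
minimized, the minimizer `W` is replaced with a QR-factor `U (ℓ + 1)`, and `V (ℓ + 1)` is a global
minimizer of `V ↦ f (U (ℓ + 1) Vᵀ)`. -/
def IsALS {m n k : ℕ} (f : Matrix (Fin m) (Fin n) ℝ → ℝ)
    (U : ℕ → Matrix (Fin m) (Fin k) ℝ) (V : ℕ → Matrix (Fin n) (Fin k) ℝ) : Prop :=
  ∀ ℓ, ∃ (Q : Matrix (Fin n) (Fin k) ℝ) (W : Matrix (Fin m) (Fin k) ℝ),
    IsQRFactor (V ℓ) Q ∧
    (∀ A : Matrix (Fin m) (Fin k) ℝ, f (W * Q.transpose) ≤ f (A * Q.transpose)) ∧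
    IsQRFactor W (U (ℓ + 1)) ∧
    ∀ B : Matrix (Fin n) (Fin k) ℝ,
      f (U (ℓ + 1) * (V (ℓ + 1)).transpose) ≤ f (U (ℓ + 1) * B.transpose)

end LowRank

/-!
Alternating least squares minimizes `f` exactly over one subspace after another, the iterate always
lying in both the old and the new subspace. Strong convexity then makes each step at most the square
root of the decrease of `f`, so the steps vanish. Along a subsequence converging to `X_*` the two
subspaces converge as well, hence `X_*` minimizes `f` over both limits and is a critical point of
`f` on the manifold. Positive definiteness of the Riemannian Hessian gives quadratic growth of `f`
around `X_*`, which traps a sequence with vanishing steps and nonincreasing values.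

For the rate, write `e` for `f - f(X_*)` and consider one minimization, over a subspace `W`. The
gradient at the iterate is orthogonal to the previous subspace, and a tangent vector at the iterate
is the sum of its projection to `W` and an element of the previous subspace, so the Riemannian
gradient is no longer than the projection `g` of the gradient to `W`. Near `X_*` one has
`2 * κ * e ≤ ‖grad f‖ ^ 2 ≤ ‖g‖ ^ 2` for every `κ` below the smallest eigenvalue of the Hessian,
while a gradient step in `W` decreases `f` by `‖g‖ ^ 2 / (2 * L)` for every `L` above the norm of
the projected Hessian. Hence `e` shrinks by a factor `1 - κ / L` in each of the two minimizations of
a sweep, and the distance to `X_*` is of the order of `√e`.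
-/

namespace LowRank

section Calculus

variable {E G : Type*} [NormedAddCommGroup E] [NormedSpace ℝ E]
  [NormedAddCommGroup G] [NormedSpace ℝ G]

theorem norm_sub_taylor_two_le {F : E → G} {A : E →L[ℝ] E →L[ℝ] G} (hA : ∀ v w, A v w = A w v)
    {x y : E} {C : ℝ} (hF : ∀ z ∈ segment ℝ x y, DifferentiableAt ℝ F z)
    (hC : ∀ z ∈ segment ℝ x y, ‖fderiv ℝ F z - fderiv ℝ F x - A (z - x)‖ ≤ C) :
    ‖F y - F x - fderiv ℝ F x (y - x) - (2⁻¹ : ℝ) • A (y - x) (y - x)‖ ≤ C * ‖y - x‖ := by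
  set r : E → G := fun z => F z - fderiv ℝ F x z - (2⁻¹ : ℝ) • A (z - x) (z - x) with hr
  have hderiv : ∀ z ∈ segment ℝ x y,
      HasFDerivWithinAt r (fderiv ℝ F z - fderiv ℝ F x - A (z - x)) (segment ℝ x y) z := by
    intro z hz
    have hsub : HasFDerivAt (fun z : E => z - x) (ContinuousLinearMap.id ℝ E) z :=
      (hasFDerivAt_id z).sub_const x
    have hquad := (A.hasFDerivAt.comp z hsub).clm_apply hsub
    refine ((((hF z hz).hasFDerivAt.sub (fderiv ℝ F x).hasFDerivAt).sub
      (hquad.const_smul (2⁻¹ : ℝ))).congr_fderiv ?_).hasFDerivWithinAt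
    ext v
    simp only [Function.comp_apply, map_sub, ContinuousLinearMap.comp_id, smul_add, sub_apply,
      add_apply, smul_apply, ContinuousLinearMap.flip_apply, hA v, sub_right_inj]
    module
  have hbound := (convex_segment x y).norm_image_sub_le_of_norm_hasFDerivWithin_le hderiv hC
    (left_mem_segment ℝ x y) (right_mem_segment ℝ x y)
  have hry : r y - r x =
      F y - F x - fderiv ℝ F x (y - x) - (2⁻¹ : ℝ) • A (y - x) (y - x) := by
    simp only [hr, map_sub, sub_self, zero_apply, smul_zero]
    abel
  rwa [hry] at hbound

theorem isLittleO_taylor_two {F : E → G} {x₀ : E} (hF : ContDiffAt ℝ 2 F x₀) :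
    (fun p : E × E => F p.2 - F p.1 - fderiv ℝ F p.1 (p.2 - p.1) -
      (2⁻¹ : ℝ) • fderiv ℝ (fderiv ℝ F) x₀ (p.2 - p.1) (p.2 - p.1)) =o[𝓝 (x₀, x₀)]
    fun p => ‖p.2 - p.1‖ ^ 2 := by
  refine Asymptotics.isLittleO_iff.2 fun ε hε => ?_
  have hstrict : HasStrictFDerivAt (fderiv ℝ F) (fderiv ℝ (fderiv ℝ F) x₀) x₀ :=
    (hF.fderiv_right (m := 1) (by norm_num)).hasStrictFDerivAt (by norm_num)
  have hdiff : ∀ᶠ z in 𝓝 x₀, DifferentiableAt ℝ F z := by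
    filter_upwards [hF.eventually (by norm_num)] with z hz using hz.differentiableAt (by norm_num)
  have hnhds := hstrict.isLittleO.bound hε
  rw [nhds_prod_eq] at hnhds ⊢
  obtain ⟨δ, hδ, hball⟩ := Metric.nhds_basis_ball.prod_self.eventually_iff.1
    (hnhds.and (hdiff.prod_inl (𝓝 x₀)))
  refine Metric.nhds_basis_ball.prod_self.eventually_iff.2 ⟨δ, hδ, fun ⟨x, y⟩ ⟨hx, hy⟩ => ?_⟩
  have hseg : segment ℝ x y ⊆ Metric.ball x₀ δ := (convex_ball x₀ δ).segment_subset hx hy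
  have htaylor := norm_sub_taylor_two_le (hF.isSymmSndFDerivAt (by simp)) (C := ε * ‖y - x‖)
    (fun z hz => (hball (x := (z, x)) ⟨hseg hz, hx⟩).2)
    (fun z hz => (hball (x := (z, x)) ⟨hseg hz, hx⟩).1.trans (by
      gcongr
      simpa only [norm_sub_rev] using norm_sub_le_of_mem_segment hz))
  rwa [norm_pow, norm_norm, pow_two, ← mul_assoc]

/-- Euler's relation for a quadratic form, up to the error of the Taylor expansion: the two
expansions of `F`, about `x₀` and about `x`, differ by the left-hand side. -/
theorem isLittleO_fderiv_sub_two_smul_sub {F : E → G} {x₀ : E} (hF : ContDiffAt ℝ 2 F x₀)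
    (h0 : fderiv ℝ F x₀ = 0) :
    (fun x => fderiv ℝ F x (x - x₀) - (2 : ℝ) • (F x - F x₀)) =o[𝓝 x₀]
      fun x => ‖x - x₀‖ ^ 2 := by
  have hT := isLittleO_taylor_two hF
  have hfrom := hT.comp_tendsto (tendsto_const_nhds.prodMk_nhds tendsto_id : Tendsto
    (fun x => (x₀, x)) (𝓝 x₀) (𝓝 (x₀, x₀)))
  have hto := hT.comp_tendsto (tendsto_id.prodMk_nhds tendsto_const_nhds : Tendsto
    (fun x => (x, x₀)) (𝓝 x₀) (𝓝 (x₀, x₀)))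
  simp only [Function.comp_def, id, norm_sub_rev x₀] at hfrom hto
  refine (hto.sub hfrom).congr_left fun x => ?_
  rw [h0, ← neg_sub x x₀]
  simp only [map_neg, neg_apply, neg_neg, zero_apply, two_smul]
  abel

theorem deriv_deriv_add_smul {F : E → G} {x₀ : E} (hF : ContDiffAt ℝ 2 F x₀) (ξ : E) :
    deriv (deriv fun t : ℝ => F (x₀ + t • ξ)) 0 = fderiv ℝ (fderiv ℝ F) x₀ ξ ξ := by
  have hline (t : ℝ) : HasDerivAt (fun t : ℝ => x₀ + t • ξ) ξ t := by
    simpa using ((hasDerivAt_id t).smul_const ξ).const_add x₀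
  have htendsto : Tendsto (fun t : ℝ => x₀ + t • ξ) (𝓝 0) (𝓝 x₀) := by
    simpa using (hline 0).continuousAt.tendsto
  have hfirst : (deriv fun t : ℝ => F (x₀ + t • ξ)) =ᶠ[𝓝 0]
      fun t => fderiv ℝ F (x₀ + t • ξ) ξ := by
    filter_upwards [htendsto.eventually (hF.eventually (by norm_num))] with t ht
    exact ((ht.differentiableAt (by norm_num)).hasFDerivAt.comp_hasDerivAt t (hline t)).deriv
  have hsecond : HasFDerivAt (fderiv ℝ F) (fderiv ℝ (fderiv ℝ F) x₀) (x₀ + (0 : ℝ) • ξ) := by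
    rw [zero_smul, add_zero]
    exact ((hF.fderiv_right (m := 1) (by norm_num)).differentiableAt (by norm_num)).hasFDerivAt
  have hderiv : HasDerivAt (fun t : ℝ => fderiv ℝ F (x₀ + t • ξ))
      (fderiv ℝ (fderiv ℝ F) x₀ ξ) 0 := hsecond.comp_hasDerivAt 0 (hline 0)
  rw [hfirst.deriv_eq]
  exact ((ContinuousLinearMap.apply ℝ G ξ).hasFDerivAt.comp_hasDerivAt 0 hderiv).deriv

theorem eventually_sub_inv_smul_le {α : Type*} {l : Filter α} {f : E → ℝ} {x₀ : E}
    (hf : ContDiffAt ℝ 2 f x₀) {x g : α → E} (hx : Tendsto x l (𝓝 x₀)) (hg : Tendsto g l (𝓝 0))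
    (hfg : ∀ a, fderiv ℝ f (x a) (g a) = ‖g a‖ ^ 2) {K L : ℝ} (hK : K < L) (hL : 0 < L)
    (hquad : ∀ᶠ a in l, fderiv ℝ (fderiv ℝ f) x₀ (g a) (g a) ≤ K * ‖g a‖ ^ 2) :
    ∀ᶠ a in l, f (x a - L⁻¹ • g a) ≤ f (x a) - (2 * L)⁻¹ * ‖g a‖ ^ 2 := by
  have hstep : Tendsto (fun a => x a - L⁻¹ • g a) l (𝓝 x₀) := by
    simpa using hx.sub (hg.const_smul L⁻¹)
  have htaylor := (isLittleO_taylor_two hf).comp_tendsto (hx.prodMk_nhds hstep)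
  filter_upwards [htaylor.bound (c := (L - K) / 2) (by linarith), hquad] with a ha hqa
  simp only [Function.comp_apply, sub_sub_cancel_left, map_neg, map_smul, neg_apply, smul_apply,
    hfg, norm_neg, norm_smul, Real.norm_eq_abs, abs_pow, abs_mul, abs_norm, smul_eq_mul,
    abs_of_pos (inv_pos.2 hL)] at ha
  have hgain : L⁻¹ ^ 2 * (2⁻¹ * fderiv ℝ (fderiv ℝ f) x₀ (g a) (g a)) ≤
      L⁻¹ ^ 2 * (2⁻¹ * (K * ‖g a‖ ^ 2)) := by gcongr
  have hL' : L⁻¹ ^ 2 * L = L⁻¹ := by field_simp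
  rw [mul_inv]
  linear_combination (le_abs_self _).trans ha + hgain + (2⁻¹ * ‖g a‖ ^ 2) * hL'

theorem eventually_apply_apply_le_of_tendsto {α : Type*} {l : Filter α} {P : α → E →L[ℝ] E}
    {S : E →L[ℝ] E} (hP : Tendsto P l (𝓝 S)) (B : E →L[ℝ] E →L[ℝ] ℝ) {K L : ℝ}
    (hS : ∀ v, B (S v) (S v) ≤ K * ‖v‖ ^ 2) (hL : K < L) :
    ∀ᶠ a in l, ∀ v, B (P a v) (P a v) ≤ L * ‖v‖ ^ 2 := by
  have hlim : Tendsto (fun a => ‖B‖ * ‖P a - S‖ * (‖P a‖ + ‖S‖)) l (𝓝 0) := by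
    simpa using ((hP.sub_const S).norm.const_mul ‖B‖).mul (hP.norm.add_const ‖S‖)
  filter_upwards [hlim.eventually_le_const (sub_pos.2 hL)] with a ha v
  have hsplit : B (P a v) (P a v) =
      B ((P a - S) v) (P a v) + B (S v) ((P a - S) v) + B (S v) (S v) := by
    simp only [sub_apply, map_sub]; ring
  have hleft : B ((P a - S) v) (P a v) ≤ ‖B‖ * (‖P a - S‖ * ‖v‖) * (‖P a‖ * ‖v‖) :=
    (Real.le_norm_self _).trans (B.le_of_opNorm₂_le_of_le le_rfl
      ((P a - S).le_opNorm v) ((P a).le_opNorm v))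
  have hright : B (S v) ((P a - S) v) ≤ ‖B‖ * (‖S‖ * ‖v‖) * (‖P a - S‖ * ‖v‖) :=
    (Real.le_norm_self _).trans (B.le_of_opNorm₂_le_of_le le_rfl
      (S.le_opNorm v) ((P a - S).le_opNorm v))
  have hsmall := mul_le_mul_of_nonneg_right ha (sq_nonneg ‖v‖)
  linarith [hS v]

theorem isLittleO_bilinear_sub {α : Type*} {l : Filter α} {u v : α → E}
    (C : E →L[ℝ] E →L[ℝ] G) (h : (fun a => u a - v a) =o[l] v) :
    (fun a => C (u a) (u a) - C (v a) (v a)) =o[l] fun a => ‖v a‖ ^ 2 := by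
  have hu : u =O[l] v := by simpa using h.isBigO.add (Asymptotics.isBigO_refl v l)
  have hC : ∀ p q : α → E, (fun a => C (p a) (q a)) =O[l] fun a => ‖p a‖ * ‖q a‖ := fun p q =>
    Asymptotics.IsBigO.of_bound ‖C‖ (Eventually.of_forall fun a => by
      simpa [mul_assoc] using C.le_opNorm₂ (p a) (q a))
  have hleft := (hC _ u).trans_isLittleO (h.norm_norm.mul_isBigO hu.norm_norm)
  have hright := (hC v _).trans_isLittleO
    ((Asymptotics.isBigO_refl (fun a => ‖v a‖) l).mul_isLittleO h.norm_norm)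
  refine ((hleft.add hright).congr_left fun a => ?_).congr_right fun a => (pow_two _).symm
  simp

end Calculus

section Sequences

theorem limsup_root_le {a : ℕ → ℝ} (ha : ∀ n, 0 ≤ a n) {r : ℝ} (hr : 0 ≤ r)
    (h : ∀ b > r, a =O[atTop] (b ^ ·)) :
    limsup (fun n : ℕ => ((a n ^ (1 / (n : ℝ)) : ℝ) : EReal)) atTop ≤ (r : EReal) := by
  refine EReal.le_of_forall_lt_iff_le.1 fun b hb => ?_
  have hb : r < b := by exact_mod_cast hb
  have hbpos : 0 < b := hr.trans_lt hb
  obtain ⟨C, hC, hle⟩ := (h b hb).exists_pos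
  have hlim : Tendsto (fun n : ℕ => ((C ^ (1 / (n : ℝ)) * b : ℝ) : EReal)) atTop
      (𝓝 (b : EReal)) := by
    refine (continuous_coe_real_ereal.tendsto _).comp ?_
    have hroot : Tendsto (fun n : ℕ => C ^ (1 / (n : ℝ))) atTop (𝓝 (C ^ (0 : ℝ))) :=
      (Real.continuousAt_const_rpow hC.ne').tendsto.comp tendsto_one_div_atTop_nhds_zero_nat
    simpa using hroot.mul_const b
  rw [← hlim.limsup_eq]
  refine limsup_le_limsup ?_
  filter_upwards [hle.bound, eventually_gt_atTop 0] with n hn hn0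
  rw [EReal.coe_le_coe_iff]
  calc a n ^ (1 / (n : ℝ)) ≤ (C * b ^ n) ^ (1 / (n : ℝ)) := by
        gcongr
        · exact ha n
        · simpa [abs_of_nonneg (ha n), abs_of_pos hbpos] using hn
    _ = C ^ (1 / (n : ℝ)) * b := by
        rw [Real.mul_rpow hC.le (by positivity), one_div,
          Real.pow_rpow_inv_natCast hbpos.le hn0.ne']

theorem isBigO_pow_of_le_mul {a : ℕ → ℝ} (ha : ∀ n, 0 ≤ a n) {θ : ℝ} (hθ : 0 < θ)
    (h : ∀ᶠ n in atTop, a (n + 1) ≤ θ * a n) : a =O[atTop] (θ ^ ·) := by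
  obtain ⟨N, hN⟩ := eventually_atTop.1 h
  refine Asymptotics.IsBigO.of_bound (a N / θ ^ N) (eventually_atTop.2 ⟨N, fun n hn => ?_⟩)
  obtain ⟨i, rfl⟩ := Nat.exists_eq_add_of_le hn
  have hgeom := le_geom (u := fun i => a (N + i)) hθ.le i fun j _ => hN (N + j) (by lia)
  rw [Real.norm_of_nonneg (ha _), Real.norm_of_nonneg (by positivity), pow_add]
  refine hgeom.trans_eq ?_
  field_simp
  simp

theorem tendsto_of_mapClusterPt_of_isolated {X : Type*} [PseudoMetricSpace X] {z : ℕ → X} {x : X}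
    (hstep : Tendsto (fun j => dist (z (j + 1)) (z j)) atTop (𝓝 0)) (hacc : MapClusterPt x atTop z)
    {δ : ℝ} (hδ : 0 < δ)
    (htrap : ∀ η > 0, ∀ᶠ j in atTop, dist (z j) x < δ → dist (z j) x < η) :
    Tendsto z atTop (𝓝 x) := by
  refine Metric.tendsto_nhds.2 fun η hη => ?_
  have hη' : 0 < min η (δ / 2) := by positivity
  obtain ⟨N, hN⟩ := eventually_atTop.1
    ((htrap _ hη').and (hstep.eventually_lt_const (half_pos hδ)))
  have hfreq := mapClusterPt_iff_frequently.1 hacc _ (Metric.ball_mem_nhds x hδ)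
  obtain ⟨i, hi, hiN⟩ := (hfreq.and_eventually (eventually_ge_atTop N)).exists
  have hstay : ∀ j ≥ i, dist (z j) x < min η (δ / 2) := by
    intro j hj
    induction j, hj using Nat.le_induction with
    | base => exact (hN i hiN).1 hi
    | succ j hj ih =>
      refine (hN (j + 1) (by lia)).1 ((dist_triangle _ (z j) _).trans_lt ?_)
      linarith [(hN j (by lia)).2, ih.trans_le (min_le_right _ _)]
  exact eventually_atTop.2 ⟨i, fun j hj => (hstay j hj).trans_le (min_le_left _ _)⟩

theorem eventually_of_even_of_odd {p : ℕ → Prop} (heven : ∀ᶠ i in atTop, p (2 * i))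
    (hodd : ∀ᶠ i in atTop, p (2 * i + 1)) : ∀ᶠ j in atTop, p j := by
  obtain ⟨N, hN⟩ := eventually_atTop.1 (heven.and hodd)
  filter_upwards [eventually_ge_atTop (2 * N)] with j hj
  obtain ⟨i, rfl | rfl⟩ := Nat.even_or_odd' j
  · exact (hN i (by omega)).1
  · exact (hN i (by omega)).2

theorem exists_interleave {α : Type*} (a b : ℕ → α) :
    ∃ z : ℕ → α, (∀ i, z (2 * i) = a i) ∧ ∀ i, z (2 * i + 1) = b i :=
  ⟨fun j => if Even j then a (j / 2) else b (j / 2), fun i => by simp, fun i => by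
    simp [Nat.mul_add_div two_pos]⟩

end Sequences

section Rates

variable {a : ℕ → ℝ} {r : ℝ}

theorem isBigO_two_mul_of_le_mul (ha : ∀ j, 0 ≤ a j) {θ : ℝ} (hθ : 0 < θ)
    (h : ∀ᶠ j in atTop, a (j + 1) ≤ θ * a j) :
    (fun n => a (2 * n)) =O[atTop] fun n => (θ ^ 2) ^ n := by
  have hO := (isBigO_pow_of_le_mul ha hθ h).comp_tendsto (tendsto_id.const_mul_atTop' two_pos)
  simpa only [Function.comp_def, id, pow_mul] using hO

theorem limsup_root_two_mul_le (ha : ∀ j, 0 ≤ a j)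
    (h : ∀ θ > r, ∀ᶠ j in atTop, a (j + 1) ≤ θ * a j) :
    limsup (fun n : ℕ => ((a (2 * n) ^ (1 / (n : ℝ)) : ℝ) : EReal)) atTop ≤
      ((r ^ 2 : ℝ) : EReal) := by
  refine limsup_root_le (fun _ => ha _) (sq_nonneg r) fun b hb => ?_
  have hb0 : 0 < b := (sq_nonneg r).trans_lt hb
  have hO := isBigO_two_mul_of_le_mul ha (Real.sqrt_pos.2 hb0) (h _ (Real.lt_sqrt_of_sq_lt hb))
  rwa [Real.sq_sqrt hb0.le] at hO

theorem limsup_root_norm_two_mul_le {F : Type*} [NormedAddCommGroup F] {u : ℕ → F}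
    (ha : ∀ j, 0 ≤ a j) (hr : 0 ≤ r) (h : ∀ θ > r, ∀ᶠ j in atTop, a (j + 1) ≤ θ * a j)
    (hu : (fun j => ‖u j‖ ^ 2) =O[atTop] a) :
    limsup (fun n : ℕ => ((‖u (2 * n)‖ ^ (1 / (n : ℝ)) : ℝ) : EReal)) atTop ≤ (r : EReal) := by
  refine limsup_root_le (fun _ => norm_nonneg _) hr fun b hb => ?_
  have hO := (hu.comp_tendsto (tendsto_id.const_mul_atTop' two_pos)).trans
    (isBigO_two_mul_of_le_mul ha (hr.trans_lt hb) (h b hb))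
  have hsq : (fun n => ‖u (2 * n)‖ ^ 2) =O[atTop] fun n => (b ^ n) ^ 2 := by
    simpa only [Function.comp_def, id, pow_right_comm] using hO
  exact hsq.of_pow two_ne_zero

end Rates

section Retraction

variable {E : Type*} [NormedAddCommGroup E] [InnerProductSpace ℝ E] {M : Set E} {ρ : E → E} {x : E}

/-- `ρ` is, near the point `x` of `M`, a `C²` retraction of the ambient space onto `M`. Such
retractions stand in for charts: the geometry of `M` near `x` is read off from `f ∘ ρ`, a function
on the ambient space. -/
structure IsLocalRetraction (M : Set E) (ρ : E → E) (x : E) : Prop where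
  base_mem : x ∈ M
  contDiffAt : ContDiffAt ℝ 2 ρ x
  eventually_mem : ∀ᶠ y in 𝓝 x, ρ y ∈ M
  eventually_eq_self : ∀ᶠ y in 𝓝 x, y ∈ M → ρ y = y

namespace IsLocalRetraction

theorem eventually (h : IsLocalRetraction M ρ x) :
    ∀ᶠ y in 𝓝[M] x, IsLocalRetraction M ρ y := by
  filter_upwards [self_mem_nhdsWithin,
    nhdsWithin_le_nhds (h.contDiffAt.eventually (by norm_num)),
    nhdsWithin_le_nhds h.eventually_mem.eventually_nhds,
    nhdsWithin_le_nhds h.eventually_eq_self.eventually_nhds] with y h₁ h₂ h₃ h₄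
    using ⟨h₁, h₂, h₃, h₄⟩

theorem apply_self (h : IsLocalRetraction M ρ x) : ρ x = x :=
  h.eventually_eq_self.self_of_nhds h.base_mem

theorem tendsto (h : IsLocalRetraction M ρ x) : Tendsto ρ (𝓝 x) (𝓝[M] x) :=
  tendsto_nhdsWithin_iff.2
    ⟨by simpa only [h.apply_self] using h.contDiffAt.continuousAt.tendsto, h.eventually_mem⟩

theorem eventuallyEq_id (h : IsLocalRetraction M ρ x) : ρ =ᶠ[𝓝[M] x] id := by
  filter_upwards [nhdsWithin_le_nhds h.eventually_eq_self, self_mem_nhdsWithin] with y h₁ h₂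
    using h₁ h₂

theorem hasFDerivAt (h : IsLocalRetraction M ρ x) : HasFDerivAt ρ (fderiv ℝ ρ x) x :=
  (h.contDiffAt.differentiableAt (by norm_num)).hasFDerivAt

theorem fderiv_mem_tangentSpaceAt (h : IsLocalRetraction M ρ x) (v : E) :
    fderiv ℝ ρ x v ∈ tangentSpaceAt M x := by
  apply Submodule.subset_span
  obtain ⟨s, hs, hsM⟩ := h.eventually_mem.exists_mem
  have hv : v ∈ tangentConeAt ℝ s x := by rw [tangentConeAt_of_mem_nhds hs]; trivial
  have hmaps := (h.hasFDerivAt.hasFDerivWithinAt (s := s)).mapsTo_tangent_cone hv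
  rw [h.apply_self] at hmaps
  exact tangentConeAt_mono (Set.image_subset_iff.2 hsM) hmaps

theorem fderiv_eq_self (h : IsLocalRetraction M ρ x) {ξ : E} (hξ : ξ ∈ tangentSpaceAt M x) :
    fderiv ℝ ρ x ξ = ξ := by
  have hid : HasFDerivWithinAt ρ (ContinuousLinearMap.id ℝ E) M x :=
    (hasFDerivWithinAt_id x M).congr_of_eventuallyEq h.eventuallyEq_id h.apply_self
  exact LinearMap.eqOn_span (f := (fderiv ℝ ρ x).toLinearMap) (g := LinearMap.id)
    (h.hasFDerivAt.hasFDerivWithinAt.unique_on hid) hξ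

theorem contDiffAt_comp (h : IsLocalRetraction M ρ x) {f : E → ℝ} (hf : ContDiffAt ℝ 2 f x) :
    ContDiffAt ℝ 2 (f ∘ ρ) x :=
  ContDiffAt.comp x (by rwa [h.apply_self]) h.contDiffAt

theorem isLocalMin_comp (h : IsLocalRetraction M ρ x) {f : E → ℝ} (hf : IsLocalMinOn f M x) :
    IsLocalMin (f ∘ ρ) x := by
  filter_upwards [h.tendsto.eventually hf] with y hy
  simpa only [Function.comp_apply, h.apply_self] using hy

end IsLocalRetraction

variable [FiniteDimensional ℝ E] {f : E → ℝ}

theorem inner_riemannianGradient {ζ : E} (hζ : ζ ∈ tangentSpaceAt M x) :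
    inner ℝ (riemannianGradient M f x) ζ = inner ℝ (gradient f x) ζ := by
  rw [riemannianGradient, Submodule.inner_starProjection_left_eq_right,
    Submodule.starProjection_eq_self_iff.2 hζ]

namespace IsLocalRetraction

theorem fderiv_comp (hρ : IsLocalRetraction M ρ x) (hf : DifferentiableAt ℝ f x) (v : E) :
    fderiv ℝ (f ∘ ρ) x v = inner ℝ (riemannianGradient M f x) (fderiv ℝ ρ x v) := by
  rw [inner_riemannianGradient (hρ.fderiv_mem_tangentSpaceAt v), inner_gradient_left,
    _root_.fderiv_comp x (by rwa [hρ.apply_self]) hρ.hasFDerivAt.differentiableAt, hρ.apply_self,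
    ContinuousLinearMap.comp_apply]

theorem riemannianGradient_eq_zero_iff (hρ : IsLocalRetraction M ρ x)
    (hf : DifferentiableAt ℝ f x) :
    riemannianGradient M f x = 0 ↔ fderiv ℝ (f ∘ ρ) x = 0 := by
  refine ⟨fun h => ContinuousLinearMap.ext fun v => by simp [hρ.fderiv_comp hf, h], fun h => ?_⟩
  have hmem : riemannianGradient M f x ∈ tangentSpaceAt M x :=
    Submodule.starProjection_apply_mem _ _
  have hself := hρ.fderiv_comp hf (riemannianGradient M f x)
  rw [h, hρ.fderiv_eq_self hmem] at hself
  simpa using hself.symm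

theorem fderiv_fderiv_comp (hρ : IsLocalRetraction M ρ x) (hf : ContDiffAt ℝ 2 f x)
    (h0 : riemannianGradient M f x = 0)
    (hD : DifferentiableWithinAt ℝ (riemannianGradient M f) M x) (ξ v : tangentSpaceAt M x) :
    fderiv ℝ (fderiv ℝ (f ∘ ρ)) x ξ v = inner ℝ (riemannianHessian M f x ξ) v := by
  have hfρ : HasFDerivAt (fderiv ℝ (f ∘ ρ)) (fderiv ℝ (fderiv ℝ (f ∘ ρ)) x) x :=
    (((hρ.contDiffAt_comp hf).fderiv_right (m := 1) (by norm_num)).differentiableAt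
      (by norm_num)).hasFDerivAt
  have hρ' : HasFDerivAt (fderiv ℝ ρ) (fderiv ℝ (fderiv ℝ ρ) x) x :=
    ((hρ.contDiffAt.fderiv_right (m := 1) (by norm_num)).differentiableAt
      (by norm_num)).hasFDerivAt
  have hleft := (hfρ.clm_apply (hasFDerivAt_const (v : E) x)).hasFDerivWithinAt (s := M)
  have hright := hD.hasFDerivWithinAt.inner ℝ
    ((hρ'.clm_apply (hasFDerivAt_const (v : E) x)).hasFDerivWithinAt (s := M))
  have heq : (fun y => fderiv ℝ (f ∘ ρ) y (v : E)) =ᶠ[𝓝[M] x]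
      fun y => inner ℝ (riemannianGradient M f y) (fderiv ℝ ρ y (v : E)) := by
    filter_upwards [hρ.eventually, nhdsWithin_le_nhds (hf.eventually (by norm_num))] with y h₁ h₂
      using h₁.fderiv_comp (h₂.differentiableAt (by norm_num)) v
  have hunique := hleft.unique_on (hright.congr_of_eventuallyEq heq
    (hρ.fderiv_comp (hf.differentiableAt (by norm_num)) v))
  have hspan := LinearMap.eqOn_span
    (f := ContinuousLinearMap.toLinearMap _) (g := ContinuousLinearMap.toLinearMap _) hunique ξ.2
  simp only [ContinuousLinearMap.comp_zero, zero_add, ContinuousLinearMap.coe_coe,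
    ContinuousLinearMap.flip_apply, h0, hρ.fderiv_eq_self v.2, ContinuousLinearMap.toLinearMap_comp,
    ContinuousLinearMap.coe_prod, LinearMap.coe_comp, Function.comp_apply, LinearMap.prod_apply,
    Function.prod_apply, fderivInnerCLM_apply, inner_zero_left] at hspan
  simp [hspan, riemannianHessian]

theorem riemannianHessian_isSymmetric (hρ : IsLocalRetraction M ρ x) (hf : ContDiffAt ℝ 2 f x)
    (h0 : riemannianGradient M f x = 0)
    (hD : DifferentiableWithinAt ℝ (riemannianGradient M f) M x) :
    (riemannianHessian M f x).IsSymmetric := fun ξ v => by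
  have hsymm : IsSymmSndFDerivAt ℝ (f ∘ ρ) x :=
    (hρ.contDiffAt_comp hf).isSymmSndFDerivAt (by simp)
  rw [← hρ.fderiv_fderiv_comp hf h0 hD, hsymm, hρ.fderiv_fderiv_comp hf h0 hD, real_inner_comm]

end IsLocalRetraction

-- A derivative that does not exist is `0` by convention, and `0` is not positive definite.
theorem differentiableWithinAt_of_isPosDef [Nontrivial (tangentSpaceAt M x)]
    (hpos : IsPosDef (riemannianHessian M f x)) :
    DifferentiableWithinAt ℝ (riemannianGradient M f) M x := by
  by_contra h
  obtain ⟨ξ, hξ⟩ := exists_ne (0 : tangentSpaceAt M x)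
  have := hpos ξ hξ
  simp [riemannianHessian, fderivWithin_zero_of_not_differentiableWithinAt h] at this

end Retraction

section LeastEigenvalue

variable {E : Type*} [NormedAddCommGroup E] [InnerProductSpace ℝ E]

theorem inner_apply_eq_of_hasEigenvector {H : E →ₗ[ℝ] E} {μ : ℝ} {v : E}
    (hv : Module.End.HasEigenvector H μ v) : inner ℝ (H v) v = μ * ‖v‖ ^ 2 := by
  rw [hv.apply_eq_smul, real_inner_smul_left, real_inner_self_eq_norm_sq]

theorem exists_isLeast_eigenvalue [FiniteDimensional ℝ E] [Nontrivial E] {H : E →ₗ[ℝ] E}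
    (hH : H.IsSymmetric) :
    ∃ l : ℝ, IsLeast {μ : ℝ | Module.End.HasEigenvalue H μ} l ∧
      ∀ v, l * ‖v‖ ^ 2 ≤ inner ℝ (H v) v := by
  have hbdd : BddBelow (Set.range fun v : { v : E // v ≠ 0 } =>
      RCLike.re (inner ℝ (H v) v) / ‖(v : E)‖ ^ 2) :=
    ⟨-‖LinearMap.toContinuousLinearMap H‖, by
      rintro _ ⟨v, rfl⟩
      exact neg_le_of_abs_le ((LinearMap.toContinuousLinearMap H).rayleighQuotient_le_norm v)⟩
  have hle : ∀ v, (⨅ v : { v : E // v ≠ 0 }, RCLike.re (inner ℝ (H v) v) / ‖(v : E)‖ ^ 2) *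
      ‖v‖ ^ 2 ≤ inner ℝ (H v) v := by
    intro v
    rcases eq_or_ne v 0 with rfl | hv
    · simp
    · exact (le_div_iff₀ (pow_pos (norm_pos_iff.2 hv) 2)).1 (ciInf_le hbdd ⟨v, hv⟩)
  refine ⟨_, ⟨hH.hasEigenvalue_iInf_of_finiteDimensional, fun μ hμ => ?_⟩, hle⟩
  obtain ⟨v, hv⟩ := Module.End.HasEigenvalue.exists_hasEigenvector hμ
  exact le_of_mul_le_mul_right ((hle v).trans_eq (inner_apply_eq_of_hasEigenvector hv))
    (pow_pos (norm_pos_iff.2 hv.2) 2)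

theorem IsPosDef.pos_of_hasEigenvalue {T : Submodule ℝ E} {H : T →ₗ[ℝ] T} (hH : IsPosDef H)
    {μ : ℝ} (hμ : Module.End.HasEigenvalue H μ) : 0 < μ := by
  obtain ⟨v, hv⟩ := hμ.exists_hasEigenvector
  have hpos := hH v hv.2
  rw [inner_apply_eq_of_hasEigenvector hv] at hpos
  exact pos_of_mul_pos_left hpos (by positivity)

end LeastEigenvalue

section CoerciveCriticalPoint

variable {E : Type*} [NormedAddCommGroup E] [InnerProductSpace ℝ E] {M : Set E} {ρ : E → E}
  {f : E → ℝ} {x₀ : E} {l κ : ℝ}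

theorem mem_tangentSpaceAt_of_add_smul_mem {ξ : E} (hline : ∀ᶠ t : ℝ in 𝓝 0, x₀ + t • ξ ∈ M) :
    ξ ∈ tangentSpaceAt M x₀ :=
  Submodule.subset_span (mem_tangentConeAt_of_add_smul_mem tendsto_id
    (hline.filter_mono nhdsWithin_le_nhds))

/-- `x₀` is a critical point of `f|_M` at which the second derivative of `f|_M`, computed with the
local retraction `ρ`, is bounded from below by `l` on the tangent space. For `0 < l` this is the
second-order sufficient condition for a local minimum. -/
structure IsCoerciveCriticalPoint (M : Set E) (ρ : E → E) (f : E → ℝ) (x₀ : E) (l : ℝ) : Prop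
    extends IsLocalRetraction M ρ x₀ where
  contDiffAt_fun : ContDiffAt ℝ 2 f x₀
  fderiv_comp_eq_zero : fderiv ℝ (f ∘ ρ) x₀ = 0
  le_fderiv_fderiv : ∀ ξ ∈ tangentSpaceAt M x₀,
    l * ‖ξ‖ ^ 2 ≤ fderiv ℝ (fderiv ℝ (f ∘ ρ)) x₀ ξ ξ

namespace IsLocalRetraction

theorem isLittleO_fderiv_sub (hρ : IsLocalRetraction M ρ x₀) :
    (fun x => fderiv ℝ ρ x₀ (x - x₀) - (x - x₀)) =o[𝓝[M] x₀] fun x => x - x₀ := by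
  refine (hρ.hasFDerivAt.isLittleO.mono nhdsWithin_le_nhds).neg_left.congr' ?_ EventuallyEq.rfl
  filter_upwards [hρ.eventuallyEq_id] with x hx
  rw [hx, hρ.apply_self, id, neg_sub]

theorem eventually_norm_fderiv_le (hρ : IsLocalRetraction M ρ x₀) {c : ℝ} (hc : 1 < c) :
    ∀ᶠ x in 𝓝[M] x₀, ‖fderiv ℝ ρ x (x - x₀)‖ ≤ c * ‖x - x₀‖ := by
  have hc' : 0 < (c - 1) / 2 := by linarith
  have hcont : ContinuousAt (fderiv ℝ ρ) x₀ :=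
    (hρ.contDiffAt.fderiv_right (m := 1) (by norm_num)).continuousAt
  filter_upwards [hρ.isLittleO_fderiv_sub.bound hc',
    nhdsWithin_le_nhds (hcont.eventually (Metric.closedBall_mem_nhds _ hc'))] with x hx hball
  rw [dist_eq_norm] at hball
  have hsplit : fderiv ℝ ρ x (x - x₀) = (fderiv ℝ ρ x - fderiv ℝ ρ x₀) (x - x₀) +
      (fderiv ℝ ρ x₀ (x - x₀) - (x - x₀)) + (x - x₀) := by
    rw [sub_apply]; abel
  calc ‖fderiv ℝ ρ x (x - x₀)‖
      ≤ (c - 1) / 2 * ‖x - x₀‖ + (c - 1) / 2 * ‖x - x₀‖ + ‖x - x₀‖ := by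
        rw [hsplit]
        refine norm_add₃_le.trans (add_le_add_three ?_ hx le_rfl)
        exact (ContinuousLinearMap.le_opNorm _ _).trans (by gcongr)
    _ = c * ‖x - x₀‖ := by ring

end IsLocalRetraction

namespace IsCoerciveCriticalPoint

theorem eventually_growth (h : IsCoerciveCriticalPoint M ρ f x₀ l) (hκ : κ < l) :
    ∀ᶠ x in 𝓝[M] x₀, κ / 2 * ‖x - x₀‖ ^ 2 ≤ f x - f x₀ := by
  have hvalue := ((isLittleO_taylor_two (h.contDiffAt_comp h.contDiffAt_fun)).comp_tendsto
    (tendsto_const_nhds.prodMk_nhds tendsto_id : Tendsto (fun x => (x₀, x)) (𝓝 x₀)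
      (𝓝 (x₀, x₀)))).mono (nhdsWithin_le_nhds (s := M))
  have hform := isLittleO_bilinear_sub
    (fderiv ℝ (fderiv ℝ (f ∘ ρ)) x₀ -
      l • (isBoundedBilinearMap_inner (𝕜 := ℝ) (E := E)).toContinuousLinearMap)
    h.isLittleO_fderiv_sub
  filter_upwards [hvalue.bound (c := (l - κ) / 4) (by linarith),
    hform.bound (c := (l - κ) / 2) (by linarith), h.eventuallyEq_id] with x hx₁ hx₂ hx₃
  have hcoercive := h.le_fderiv_fderiv _ (h.fderiv_mem_tangentSpaceAt (x - x₀))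
  simp only [Function.comp_apply, id, hx₃, h.apply_self, h.fderiv_comp_eq_zero, zero_apply,
    norm_pow, Real.norm_eq_abs, abs_norm, smul_eq_mul, sub_apply, smul_apply,
    IsBoundedBilinearMap.toContinuousLinearMap_apply, real_inner_self_eq_norm_sq] at hx₁ hx₂
  linarith [(abs_le.1 hx₁).1, (abs_le.1 hx₂).2]

theorem isBigO_sq_norm_sub (h : IsCoerciveCriticalPoint M ρ f x₀ l) (hl : 0 < l) {α : Type*}
    {𝓕 : Filter α} {z : α → E} (hz : Tendsto z 𝓕 (𝓝 x₀)) (hM : ∀ᶠ a in 𝓕, z a ∈ M) :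
    (fun a => ‖z a - x₀‖ ^ 2) =O[𝓕] fun a => f (z a) - f x₀ := by
  have hlim : Tendsto z 𝓕 (𝓝[M] x₀) := tendsto_nhdsWithin_iff.2 ⟨hz, hM⟩
  refine Asymptotics.IsBigO.of_bound (4 / l) ?_
  filter_upwards [hlim.eventually (h.eventually_growth (half_lt_self hl))] with a ha
  rw [Real.norm_of_nonneg (sq_nonneg _), div_mul_eq_mul_div, le_div_iff₀ hl]
  linarith [le_abs_self (f (z a) - f x₀), Real.norm_eq_abs (f (z a) - f x₀)]

theorem eventually_mul_le_fderiv (h : IsCoerciveCriticalPoint M ρ f x₀ l) (hl : 0 < l) {c : ℝ}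
    (hc : c < 1) :
    ∀ᶠ x in 𝓝[M] x₀, c * (2 * (f x - f x₀)) ≤ fderiv ℝ (f ∘ ρ) x (x - x₀) := by
  have heuler := (isLittleO_fderiv_sub_two_smul_sub (h.contDiffAt_comp h.contDiffAt_fun)
    h.fderiv_comp_eq_zero).mono (nhdsWithin_le_nhds (s := M))
  filter_upwards [heuler.bound (c := (1 - c) * (l / 2)) (by nlinarith),
    h.eventually_growth (half_lt_self hl), h.eventuallyEq_id] with x hx hgrowth hid
  simp only [Function.comp_apply, hid, id, h.apply_self, Real.norm_eq_abs, norm_pow, abs_norm,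
    smul_eq_mul] at hx
  nlinarith [(abs_le.1 hx).1, mul_le_mul_of_nonneg_left hgrowth (sub_nonneg.2 hc.le)]

theorem le_of_line_mem (h : IsCoerciveCriticalPoint M ρ f x₀ l) {ξ : E} (hξ0 : ξ ≠ 0)
    (hline : ∀ᶠ t : ℝ in 𝓝 0, x₀ + t • ξ ∈ M)
    {Λ : ℝ} (hΛ : fderiv ℝ (fderiv ℝ f) x₀ ξ ξ ≤ Λ * ‖ξ‖ ^ 2) : l ≤ Λ := by
  have htendsto : Tendsto (fun t : ℝ => x₀ + t • ξ) (𝓝 0) (𝓝 x₀) :=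
    Continuous.tendsto' (by fun_prop) _ _ (by simp)
  have heq : (fun t : ℝ => (f ∘ ρ) (x₀ + t • ξ)) =ᶠ[𝓝 0] fun t => f (x₀ + t • ξ) := by
    filter_upwards [htendsto.eventually h.eventually_eq_self, hline] with t h₁ h₂
    rw [Function.comp_apply, h₁ h₂]
  have hsecond : fderiv ℝ (fderiv ℝ (f ∘ ρ)) x₀ ξ ξ = fderiv ℝ (fderiv ℝ f) x₀ ξ ξ := by
    rw [← deriv_deriv_add_smul (h.contDiffAt_comp h.contDiffAt_fun),
      ← deriv_deriv_add_smul h.contDiffAt_fun, heq.deriv.deriv_eq]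
  have hle := (h.le_fderiv_fderiv ξ (mem_tangentSpaceAt_of_add_smul_mem hline)).trans
    (hsecond.trans_le hΛ)
  exact le_of_mul_le_mul_right hle (pow_pos (norm_pos_iff.2 hξ0) 2)

variable [FiniteDimensional ℝ E]

theorem of_isPosDef [Nontrivial (tangentSpaceAt M x₀)] (hρ : IsLocalRetraction M ρ x₀)
    (hf : ContDiffAt ℝ 2 f x₀) (h0 : riemannianGradient M f x₀ = 0)
    (hpos : IsPosDef (riemannianHessian M f x₀)) :
    ∃ l, IsLeast {μ : ℝ | Module.End.HasEigenvalue (riemannianHessian M f x₀) μ} l ∧ 0 < l ∧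
      IsCoerciveCriticalPoint M ρ f x₀ l := by
  have hD := differentiableWithinAt_of_isPosDef hpos
  obtain ⟨l, hleast, hl⟩ :=
    exists_isLeast_eigenvalue (hρ.riemannianHessian_isSymmetric hf h0 hD)
  refine ⟨l, hleast, hpos.pos_of_hasEigenvalue hleast.1, hρ, hf, ?_, fun ξ hξ => ?_⟩
  · rwa [← hρ.riemannianGradient_eq_zero_iff (hf.differentiableAt (by norm_num))]
  · exact (hl ⟨ξ, hξ⟩).trans_eq (hρ.fderiv_fderiv_comp hf h0 hD ⟨ξ, hξ⟩ ⟨ξ, hξ⟩).symm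

theorem eventually_gradient_domination (h : IsCoerciveCriticalPoint M ρ f x₀ l) (hκ0 : 0 ≤ κ)
    (hκ : κ < l) :
    ∀ᶠ x in 𝓝[M] x₀, 2 * κ * (f x - f x₀) ≤ ‖riemannianGradient M f x‖ ^ 2 := by
  obtain ⟨c, hκc, hc0, hc1⟩ : ∃ c : ℝ, κ ≤ c ^ 5 * l ∧ 0 < c ∧ c < 1 := by
    have hlim : Tendsto (fun c : ℝ => c ^ 5 * l) (𝓝[<] 1) (𝓝 (1 ^ 5 * l)) :=
      ((continuous_id.pow 5).mul_const l).continuousAt.tendsto.mono_left nhdsWithin_le_nhds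
    obtain ⟨c, hc, hc'⟩ := ((hlim.eventually_const_lt (by simpa using hκ)).and
      (Ioo_mem_nhdsLT zero_lt_one)).exists
    exact ⟨c, hc.le, hc'⟩
  have hl : 0 < l := hκ0.trans_lt hκ
  filter_upwards [h.eventually_growth (mul_lt_of_lt_one_left hl hc1),
    h.eventually_mul_le_fderiv hl hc1, h.eventually_norm_fderiv_le ((one_lt_inv₀ hc0).2 hc1),
    h.eventually, nhdsWithin_le_nhds (h.contDiffAt_fun.eventually (by norm_num))]
    with x hgrowth heuler hnorm hρ hf
  set N := ‖riemannianGradient M f x‖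
  set F := f x - f x₀
  set d := ‖x - x₀‖
  have hF : 0 ≤ F := hgrowth.trans' (by positivity)
  have hcauchy : c ^ 2 * (2 * F) ≤ N * d := by
    rw [hρ.fderiv_comp (hf.differentiableAt (by norm_num))] at heuler
    calc c ^ 2 * (2 * F) = c * (c * (2 * F)) := by ring
      _ ≤ c * (N * (c⁻¹ * d)) := by
        refine mul_le_mul_of_nonneg_left ?_ hc0.le
        exact heuler.trans ((real_inner_le_norm _ _).trans (by gcongr))
      _ = N * d := by field_simp
  rcases hF.eq_or_lt with hF0 | hF0
  · rw [← hF0, mul_zero]; positivity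
  refine (show 2 * κ * F ≤ 2 * (c ^ 5 * l) * F by gcongr).trans ?_
  have hsq : (c ^ 2 * (2 * F)) ^ 2 * (c * l) ≤ N ^ 2 * (2 * F) := by
    calc (c ^ 2 * (2 * F)) ^ 2 * (c * l) ≤ (N * d) ^ 2 * (c * l) := by gcongr
      _ = N ^ 2 * (2 * (c * l / 2 * d ^ 2)) := by ring
      _ ≤ N ^ 2 * (2 * F) := by gcongr
  refine le_of_mul_le_mul_right (hsq.trans' (le_of_eq ?_)) (by positivity : 0 < 2 * F)
  ring

theorem isIsolatedLocalMinOn (h : IsCoerciveCriticalPoint M ρ f x₀ l) (hl : 0 < l) :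
    IsIsolatedLocalMinOn f M x₀ := by
  have hgrowth := h.eventually_growth (half_lt_self hl)
  refine ⟨h.base_mem, ?_, ?_⟩
  · filter_upwards [hgrowth] with x hx
    exact sub_nonneg.1 (hx.trans' (by positivity))
  · have hle : 𝓝[M \ {x₀}] x₀ ≤ 𝓝[M] x₀ := nhdsWithin_mono _ Set.sdiff_subset
    filter_upwards [hle hgrowth, self_mem_nhdsWithin, hle h.eventually,
      hle (h.eventually_gradient_domination (half_pos hl).le (half_lt_self hl)),
      nhdsWithin_le_nhds (h.contDiffAt_fun.eventually (by norm_num))] with x hx hne hρ hPL hf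
    have hlt : 0 < f x - f x₀ :=
      hx.trans_lt' (by have := norm_pos_iff.2 (sub_ne_zero.2 hne.2); positivity)
    refine ⟨sub_pos.1 hlt, fun hmin => ?_⟩
    rw [(hρ.riemannianGradient_eq_zero_iff (hf.differentiableAt (by norm_num))).2
      (hρ.isLocalMin_comp hmin).fderiv_eq_zero, norm_zero] at hPL
    nlinarith

end IsCoerciveCriticalPoint

end CoerciveCriticalPoint

section SubspaceMinimization

variable {E : Type*} [NormedAddCommGroup E] [InnerProductSpace ℝ E] {f : E → ℝ}
  {W : ℕ → Submodule ℝ E} {z : ℕ → E} {x₀ : E}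

/-- `z` is generated by successive exact minimization of `f` over the subspaces `W 0, W 1, …`,
where each iterate also lies in the next subspace. Alternating least squares is of this form, with
each of its sweeps split into two steps. -/
structure IsSubspaceMinimization (f : E → ℝ) (W : ℕ → Submodule ℝ E) (z : ℕ → E) : Prop where
  mem : ∀ j, z j ∈ W j
  succ_mem : ∀ j, z (j + 1) ∈ W j
  isMinOn : ∀ j, IsMinOn f (W j) (z (j + 1))

namespace IsSubspaceMinimization

theorem antitone (h : IsSubspaceMinimization f W z) : Antitone fun j => f (z j) :=
  antitone_nat_of_succ_le fun j => h.isMinOn j (h.mem j)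

theorem tendsto_value (h : IsSubspaceMinimization f W z) (hf : Continuous f)
    (hacc : MapClusterPt x₀ atTop z) : Tendsto (fun j => f (z j)) atTop (𝓝 (f x₀)) := by
  obtain ⟨φ, hφ, hz⟩ := hacc.tendsto_subseq
  exact (tendsto_iff_tendsto_subseq_of_antitone h.antitone hφ.tendsto_atTop).2
    ((hf.tendsto x₀).comp hz)

theorem le_value (h : IsSubspaceMinimization f W z) (hf : Continuous f)
    (hacc : MapClusterPt x₀ atTop z) (j : ℕ) : f x₀ ≤ f (z j) :=
  h.antitone.le_of_tendsto (h.tendsto_value hf hacc) j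

theorem tendsto_of_growth (h : IsSubspaceMinimization f W z) {M : Set E} (hf : Continuous f)
    (hstep : Tendsto (fun j => z (j + 1) - z j) atTop (𝓝 0)) (hacc : MapClusterPt x₀ atTop z)
    {c : ℝ} (hc : 0 < c) (hgrowth : ∀ᶠ x in 𝓝[M] x₀, c * ‖x - x₀‖ ^ 2 ≤ f x - f x₀)
    (hM : ∀ᶠ x in 𝓝 x₀, x ∈ Set.range z → x ∈ M) : Tendsto z atTop (𝓝 x₀) := by
  obtain ⟨δ, hδ, hball⟩ := Metric.eventually_nhds_iff.1
    ((eventually_nhdsWithin_iff.1 hgrowth).and hM)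
  have hvalue : Tendsto (fun j => f (z j) - f x₀) atTop (𝓝 0) := by
    simpa using (h.tendsto_value hf hacc).sub_const (f x₀)
  refine tendsto_of_mapClusterPt_of_isolated (by simpa [dist_eq_norm] using hstep.norm) hacc hδ
    fun η hη => ?_
  filter_upwards [hvalue.eventually_lt_const (show 0 < c * η ^ 2 by positivity)] with j hj hjδ
  have hlt := ((hball hjδ).1 ((hball hjδ).2 ⟨j, rfl⟩)).trans_lt hj
  rw [dist_eq_norm]
  exact lt_of_pow_lt_pow_left₀ 2 hη.le (lt_of_mul_lt_mul_left hlt hc.le)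

end IsSubspaceMinimization

variable [FiniteDimensional ℝ E]

theorem isMinOn_of_tendsto_starProjection {ι : Type*} {l : Filter ι} [l.NeBot]
    {V : ι → Submodule ℝ E} {y : ι → E} {W₀ : Submodule ℝ E} (hf : Continuous f)
    (hmin : ∀ i, IsMinOn f (V i) (y i)) (hy : Tendsto (fun i => f (y i)) l (𝓝 (f x₀)))
    (hV : Tendsto (fun i => (V i).starProjection) l (𝓝 W₀.starProjection)) :
    IsMinOn f W₀ x₀ := fun w hw => by
  have hproj : Tendsto (fun i => (V i).starProjection w) l (𝓝 w) := by
    simpa only [Function.comp_def, Submodule.starProjection_eq_self_iff.2 hw] using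
      ((continuous_eval_const (F := E →L[ℝ] E) w).tendsto _).comp hV
  exact le_of_tendsto_of_tendsto' hy ((hf.tendsto w).comp hproj) fun i =>
    hmin i (Submodule.starProjection_apply_mem _ _)

theorem starProjection_gradient_eq_zero {V : Submodule ℝ E} {x : E} (hf : DifferentiableAt ℝ f x)
    (hx : x ∈ V) (hmin : IsMinOn f V x) : V.starProjection (gradient f x) = 0 := by
  refine (Submodule.starProjection_apply_eq_zero_iff _).2 fun w hw => ?_
  have htangent : ∀ v ∈ V, v ∈ posTangentConeAt (V : Set E) x := fun v hv =>
    mem_posTangentConeAt_of_segment_subset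
      (V.convex.segment_subset hx (V.add_mem hx hv))
  rw [real_inner_comm, inner_gradient_left]
  exact hmin.localize.hasFDerivWithinAt_eq_zero hf.hasFDerivAt.hasFDerivWithinAt (htangent w hw)
    (htangent _ (V.neg_mem hw))

theorem norm_riemannianGradient_le {M : Set E} {V V' : Submodule ℝ E} {x : E}
    (hV : V.starProjection (gradient f x) = 0)
    (hT : ∀ ζ ∈ tangentSpaceAt M x, ζ - V'.starProjection ζ ∈ V) :
    ‖riemannianGradient M f x‖ ≤ ‖V'.starProjection (gradient f x)‖ := by
  set ζ := riemannianGradient M f x with hζ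
  have hmem : ζ ∈ tangentSpaceAt M x := Submodule.starProjection_apply_mem _ _
  have horth : inner ℝ (gradient f x) (ζ - V'.starProjection ζ) = 0 := by
    rw [← Submodule.starProjection_eq_self_iff.2 (hT ζ hmem),
      ← Submodule.inner_starProjection_left_eq_right, hV, inner_zero_left]
  have hsq : ‖ζ‖ ^ 2 ≤ ‖V'.starProjection (gradient f x)‖ * ‖ζ‖ := calc
    ‖ζ‖ ^ 2 = inner ℝ (gradient f x) ζ := by
      rw [← inner_riemannianGradient hmem, ← hζ, real_inner_self_eq_norm_sq]
    _ = inner ℝ (V'.starProjection (gradient f x)) ζ := by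
      rw [Submodule.inner_starProjection_left_eq_right, ← sub_eq_zero, ← inner_sub_right, horth]
    _ ≤ ‖V'.starProjection (gradient f x)‖ * ‖ζ‖ := real_inner_le_norm _ _
  by_contra! hlt
  nlinarith [norm_nonneg (V'.starProjection (gradient f x))]

namespace IsSubspaceMinimization

theorem starProjection_gradient_succ (h : IsSubspaceMinimization f W z) (hf : Differentiable ℝ f)
    (j : ℕ) : (W j).starProjection (gradient f (z (j + 1))) = 0 :=
  starProjection_gradient_eq_zero (hf _) (h.succ_mem j) (h.isMinOn j)

theorem sq_step_le (h : IsSubspaceMinimization f W z) (hf : Differentiable ℝ f) {μ : ℝ}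
    (hμ : ∀ x y, f x + inner ℝ (gradient f x) (y - x) + μ / 2 * ‖y - x‖ ^ 2 ≤ f y) (j : ℕ) :
    μ / 2 * ‖z (j + 1) - z j‖ ^ 2 ≤ f (z j) - f (z (j + 1)) := by
  have horth : inner ℝ (gradient f (z (j + 1))) (z j - z (j + 1)) = 0 :=
    Submodule.inner_left_of_mem_orthogonal ((W j).sub_mem (h.mem j) (h.succ_mem j))
      ((Submodule.starProjection_apply_eq_zero_iff _).1 (h.starProjection_gradient_succ hf j))
  have hconv := hμ (z (j + 1)) (z j)
  rw [horth, norm_sub_rev] at hconv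
  linarith

theorem tendsto_step (h : IsSubspaceMinimization f W z) (hf : Differentiable ℝ f)
    (hconv : IsStronglyConvex f) (hacc : MapClusterPt x₀ atTop z) :
    Tendsto (fun j => z (j + 1) - z j) atTop (𝓝 0) := by
  obtain ⟨μ, hμ, hc⟩ := hconv
  have hvalue := h.tendsto_value hf.continuous hacc
  have hdecrease : Tendsto (fun j => 2 / μ * (f (z j) - f (z (j + 1)))) atTop (𝓝 0) := by
    simpa using (hvalue.sub ((tendsto_add_atTop_iff_nat 1).2 hvalue)).const_mul (2 / μ)
  have hsq : Tendsto (fun j => ‖z (j + 1) - z j‖ ^ 2) atTop (𝓝 0) := by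
    refine squeeze_zero (fun _ => by positivity) (fun j => ?_) hdecrease
    rw [div_mul_eq_mul_div, le_div_iff₀ hμ]
    linarith [h.sq_step_le hf hc j]
  exact tendsto_zero_iff_norm_tendsto_zero.2 (by simpa using hsq.sqrt)

theorem tendsto_starProjection_gradient (h : IsSubspaceMinimization f W z)
    (hf : Differentiable ℝ f) (hcont : ContinuousAt (gradient f) x₀)
    (hz : Tendsto z atTop (𝓝 x₀)) :
    Tendsto (fun j => (W j).starProjection (gradient f (z j))) atTop (𝓝 0) := by
  have hgrad : Tendsto (fun j => gradient f (z j)) atTop (𝓝 (gradient f x₀)) :=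
    hcont.tendsto.comp hz
  refine squeeze_zero_norm (fun j => ?_)
    (by simpa using (hgrad.sub ((tendsto_add_atTop_iff_nat 1).2 hgrad)).norm)
  rw [← sub_zero ((W j).starProjection _), ← h.starProjection_gradient_succ hf, ← map_sub]
  exact Submodule.norm_starProjection_apply_le _ _

theorem eventually_norm_riemannianGradient_le (h : IsSubspaceMinimization f W z) {M : Set E}
    (hf : Differentiable ℝ f) (hT : ∀ᶠ j in atTop, ∀ ζ ∈ tangentSpaceAt M (z (j + 1)),
      ζ - (W (j + 1)).starProjection ζ ∈ W j) :
    ∀ᶠ j in atTop,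
      ‖riemannianGradient M f (z j)‖ ≤ ‖(W j).starProjection (gradient f (z j))‖ := by
  rw [← map_add_atTop_eq_nat 1, eventually_map]
  filter_upwards [hT] with j hj
    using norm_riemannianGradient_le (h.starProjection_gradient_succ hf j) hj

theorem eventually_contraction (h : IsSubspaceMinimization f W z) {M : Set E} {ρ : E → E} {l Λ : ℝ}
    (hf : Differentiable ℝ f) (hx₀ : IsCoerciveCriticalPoint M ρ f x₀ l) (hl : 0 < l)
    (hΛ : 0 < Λ) (hz : Tendsto z atTop (𝓝 x₀)) (hM : ∀ᶠ j in atTop, z j ∈ M)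
    (hT : ∀ᶠ j in atTop, ∀ ζ ∈ tangentSpaceAt M (z (j + 1)),
      ζ - (W (j + 1)).starProjection ζ ∈ W j)
    (hW : ∀ L > Λ, ∀ᶠ j in atTop, ∀ w ∈ W j,
      fderiv ℝ (fderiv ℝ f) x₀ w w ≤ L * ‖w‖ ^ 2)
    {θ : ℝ} (hθ : 1 - l / Λ < θ) :
    ∀ᶠ j in atTop, f (z (j + 1)) - f x₀ ≤ θ * (f (z j) - f x₀) := by
  obtain ⟨q, hq, hql⟩ := exists_between (max_lt (div_pos hl hΛ) (sub_lt_comm.1 hθ))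
  obtain ⟨hq0, hqθ⟩ := max_lt_iff.1 hq
  obtain ⟨κ, hqκ, hκl⟩ := exists_between ((lt_div_iff₀ hΛ).1 hql)
  obtain ⟨K, hΛK, hKκ⟩ := exists_between ((lt_div_iff₀ hq0).2 (by rwa [mul_comm]))
  have hκ0 : 0 < κ := hqκ.trans' (by positivity)
  have hcont : ContinuousAt (gradient f) x₀ :=
    ((InnerProductSpace.toDual ℝ E).symm.continuous.continuousAt).comp
      (hx₀.contDiffAt_fun.fderiv_right (m := 1) (by norm_num)).continuousAt
  have hinner : ∀ j, fderiv ℝ f (z j) ((W j).starProjection (gradient f (z j))) =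
      ‖(W j).starProjection (gradient f (z j))‖ ^ 2 := fun j => by
    rw [← inner_gradient_left, real_inner_comm]
    exact Submodule.re_inner_starProjection_eq_normSq (W j) (gradient f (z j))
  -- Minimizing over `W j` does at least as well as a gradient step of length `q / κ` in `W j`.
  have hdescent := eventually_sub_inv_smul_le hx₀.contDiffAt_fun hz
    (h.tendsto_starProjection_gradient hf hcont hz) hinner hKκ (div_pos hκ0 hq0)
    ((hW K hΛK).mono fun j hj => hj _ (Submodule.starProjection_apply_mem _ _))
  have hdomination := (tendsto_nhdsWithin_iff.2 ⟨hz, hM⟩).eventually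
    (hx₀.eventually_gradient_domination hκ0.le hκl)
  filter_upwards [hdescent, hdomination, h.eventually_norm_riemannianGradient_le hf hT]
    with j hdesc hdom hgrad
  set g := (W j).starProjection (gradient f (z j))
  set e := f (z j) - f x₀
  have he : 0 ≤ e := sub_nonneg.2 (h.le_value hf.continuous hz.mapClusterPt j)
  have hstep : f (z (j + 1)) ≤ f (z j - (κ / q)⁻¹ • g) :=
    h.isMinOn j ((W j).sub_mem (h.mem j)
      ((W j).smul_mem _ (Submodule.starProjection_apply_mem _ _)))
  have hdecrease : q * e ≤ (2 * (κ / q))⁻¹ * ‖g‖ ^ 2 := calc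
    q * e = (2 * (κ / q))⁻¹ * (2 * κ * e) := by field_simp
    _ ≤ (2 * (κ / q))⁻¹ * ‖g‖ ^ 2 := by
      have := hdom.trans (pow_le_pow_left₀ (norm_nonneg _) hgrad 2)
      gcongr
  nlinarith

end IsSubspaceMinimization
end SubspaceMinimization

section EuclideanHessian

variable {E : Type*} [NormedAddCommGroup E] [InnerProductSpace ℝ E] [FiniteDimensional ℝ E]
  {f : E → ℝ} {x : E}

theorem differentiableAt_gradient (h : DifferentiableAt ℝ (fderiv ℝ f) x) :
    DifferentiableAt ℝ (gradient f) x := by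
  set b := stdOrthonormalBasis ℝ E
  have hexpansion : gradient f = fun y => ∑ i, fderiv ℝ f y (b i) • b i := by
    ext y
    rw [← b.sum_repr (gradient f y)]
    exact Finset.sum_congr rfl fun i _ => by
      rw [b.repr_apply_apply, real_inner_comm, inner_gradient_left]
  rw [hexpansion]
  fun_prop

theorem inner_euclideanHessian (hf : ContDiffAt ℝ 2 f x) (v w : E) :
    inner ℝ (euclideanHessian f x v) w = fderiv ℝ (fderiv ℝ f) x v w := by
  have hdf : DifferentiableAt ℝ (fderiv ℝ f) x :=
    (hf.fderiv_right (m := 1) (by norm_num)).differentiableAt (by norm_num)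
  have hinner := (differentiableAt_gradient hdf).hasFDerivAt.inner ℝ (hasFDerivAt_const w x)
  simp only [inner_gradient_left] at hinner
  simpa [fderivInnerCLM_apply, euclideanHessian] using
    DFunLike.congr_fun (hinner.unique (hdf.hasFDerivAt.clm_apply (hasFDerivAt_const w x))) v

theorem fderiv_fderiv_apply_le_opNorm (hf : ContDiffAt ℝ 2 f x) {S : E →L[ℝ] E}
    (hS : (S : E →ₗ[ℝ] E).IsSymmetric) (v : E) :
    fderiv ℝ (fderiv ℝ f) x (S v) (S v) ≤ ‖S ∘L euclideanHessian f x ∘L S‖ * ‖v‖ ^ 2 := calc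
  fderiv ℝ (fderiv ℝ f) x (S v) (S v) = inner ℝ ((S ∘L euclideanHessian f x ∘L S) v) v := by
    rw [← inner_euclideanHessian hf]
    exact (hS _ _).symm
  _ ≤ ‖(S ∘L euclideanHessian f x ∘L S) v‖ * ‖v‖ := real_inner_le_norm _ _
  _ ≤ ‖S ∘L euclideanHessian f x ∘L S‖ * ‖v‖ * ‖v‖ := by
    gcongr
    exact ContinuousLinearMap.le_opNorm _ _
  _ = ‖S ∘L euclideanHessian f x ∘L S‖ * ‖v‖ ^ 2 := by ring

theorem eventually_fderiv_fderiv_le_of_tendsto_starProjection {α : Type*} {l : Filter α}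
    {W : α → Submodule ℝ E} {S : E →L[ℝ] E} (hW : Tendsto (fun a => (W a).starProjection) l (𝓝 S))
    (hS : (S : E →ₗ[ℝ] E).IsSymmetric) (hf : ContDiffAt ℝ 2 f x) {L : ℝ}
    (hL : ‖S ∘L euclideanHessian f x ∘L S‖ < L) :
    ∀ᶠ a in l, ∀ w ∈ W a, fderiv ℝ (fderiv ℝ f) x w w ≤ L * ‖w‖ ^ 2 := by
  filter_upwards [eventually_apply_apply_le_of_tendsto hW (fderiv ℝ (fderiv ℝ f) x)
    (fderiv_fderiv_apply_le_opNorm hf hS) hL] with a ha w hw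
  simpa only [Submodule.starProjection_eq_self_iff.2 hw] using ha w

end EuclideanHessian

section Rank
open Matrix

theorem card_le_rank_of_isUnit_det {R m n p : Type*} [CommRing R] [Nontrivial R] [Fintype m]
    [Fintype n] [Fintype p] [DecidableEq p] {A : Matrix p m R} {X : Matrix m n R} {B : Matrix n p R}
    (h : IsUnit (A * X * B).det) : Fintype.card p ≤ X.rank := calc
  Fintype.card p = (A * X * B).rank := (rank_of_isUnit _ ((isUnit_iff_isUnit_det _).2 h)).symm
  _ ≤ (A * X).rank := rank_mul_le_left _ _
  _ ≤ X.rank := rank_mul_le_right _ _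

variable {K m n p q : Type*} [Field K] [Fintype n]

theorem isUnit_det_of_card_le_rank [Fintype p] [DecidableEq p] {S : Matrix p p K}
    (h : Fintype.card p ≤ S.rank) : IsUnit S.det := by
  rw [← isUnit_iff_isUnit_det, ← linearIndependent_cols_iff_isUnit,
    linearIndependent_iff_card_le_finrank_span]
  exact h.trans_eq S.rank_eq_finrank_span_cols

theorem mul_eq_zero_of_rank_le [Fintype m] {A : Matrix p m K} {X : Matrix m n K}
    {D : Matrix n q K} (hr : X.rank ≤ (A * X).rank) (h : A * X * D = 0) : X * D = 0 := by
  have hle : X.mulVecLin.ker ≤ (A * X).mulVecLin.ker := by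
    rw [mulVecLin_mul]
    exact LinearMap.ker_le_ker_comp _ _
  have hker : X.mulVecLin.ker = (A * X).mulVecLin.ker := by
    refine Submodule.eq_of_le_of_finrank_le hle ?_
    have hX := X.mulVecLin.finrank_range_add_finrank_ker
    have hAX := (A * X).mulVecLin.finrank_range_add_finrank_ker
    simp only [Matrix.rank] at hr
    omega
  have hcol : ∀ j, D.col j ∈ X.mulVecLin.ker := fun j => by
    rw [hker, LinearMap.mem_ker]
    exact congrArg (fun C => C.col j) h
  ext i j
  exact congrFun (hcol j) i

theorem mul_mul_inv_mul_eq_self_of_rank_le [Fintype m] [Fintype p] [DecidableEq p]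
    {A : Matrix p m K} {X : Matrix m n K} {B : Matrix n p K} (h : IsUnit (A * X * B).det)
    (hr : X.rank ≤ Fintype.card p) : X * B * (A * X * B)⁻¹ * (A * X) = X := by
  classical
  have hAX : X.rank ≤ (A * X).rank :=
    hr.trans (card_le_rank_of_isUnit_det (A := 1) (B := B) (by rwa [Matrix.one_mul]))
  have hzero : A * X * (B * ((A * X * B)⁻¹ * (A * X)) - 1) = 0 := by
    rw [Matrix.mul_sub, ← Matrix.mul_assoc, mul_nonsing_inv_cancel_left _ _ h, Matrix.mul_one,
      sub_self]
  have hX := mul_eq_zero_of_rank_le hAX hzero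
  rwa [Matrix.mul_sub, Matrix.mul_one, sub_eq_zero, ← Matrix.mul_assoc, ← Matrix.mul_assoc] at hX

theorem mul_transpose_eq_of_mul_mul_transpose_eq {R : Type*} [CommRing R] [Fintype p]
    [DecidableEq p] {C : Matrix p n R} {Q : Matrix n p R} (hQ : Qᵀ * Q = 1) (hC : C * (Q * Qᵀ) = C)
    (h : IsUnit (C * Cᵀ).det) : Cᵀ * (C * Cᵀ)⁻¹ * C = Q * Qᵀ := by
  obtain ⟨T, rfl⟩ : ∃ T : Matrix p p R, T * Qᵀ = C := ⟨C * Q, by rwa [Matrix.mul_assoc]⟩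
  have hgram : T * Qᵀ * (T * Qᵀ)ᵀ = T * Tᵀ := by
    rw [transpose_mul, transpose_transpose, Matrix.mul_assoc, ← Matrix.mul_assoc Qᵀ, hQ,
      Matrix.one_mul]
  rw [hgram, det_mul] at h
  have hT : IsUnit T.det := isUnit_of_mul_isUnit_left h
  have hTt : IsUnit Tᵀ.det := isUnit_of_mul_isUnit_right h
  calc (T * Qᵀ)ᵀ * (T * Qᵀ * (T * Qᵀ)ᵀ)⁻¹ * (T * Qᵀ)
      = Q * (Tᵀ * Tᵀ⁻¹ * (T⁻¹ * T)) * Qᵀ := by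
        rw [hgram, Matrix.mul_inv_rev, transpose_mul, transpose_transpose]
        simp only [Matrix.mul_assoc]
    _ = Q * Qᵀ := by
        rw [mul_nonsing_inv _ hTt, nonsing_inv_mul _ hT, Matrix.one_mul, Matrix.mul_one]

end Rank

section MatrixCalculus
open Matrix

variable {m n k p q : ℕ}

/-- Multiplication of rectangular matrices as a continuous bilinear map, so that the calculus of
bilinear maps applies to products of matrix-valued functions. -/
noncomputable def mulCLM : Matrix (Fin m) (Fin n) ℝ →L[ℝ] Matrix (Fin n) (Fin p) ℝ →L[ℝ]
    Matrix (Fin m) (Fin p) ℝ :=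
  LinearMap.mkContinuous₂ (LinearMap.mk₂ ℝ (fun A B => A * B) Matrix.add_mul Matrix.smul_mul
    Matrix.mul_add fun c A B => Matrix.mul_smul A c B) 1
    fun A B => (frobenius_norm_mul A B).trans_eq (by rw [one_mul])

variable {E : Type*} [NormedAddCommGroup E] [NormedSpace ℝ E] {r : WithTop ℕ∞} {x : E}
  {a : E → Matrix (Fin m) (Fin n) ℝ} {b : E → Matrix (Fin n) (Fin p) ℝ}

theorem contDiffAt_mul (ha : ContDiffAt ℝ r a x) (hb : ContDiffAt ℝ r b x) :
    ContDiffAt ℝ r (fun y => a y * b y) x :=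
  (mulCLM (m := m) (n := n) (p := p)).isBoundedBilinearMap.contDiff.contDiffAt.comp x
    (ha.prodMk hb)

theorem hasFDerivAt_mul_zero (ha : DifferentiableAt ℝ a x) (hb : DifferentiableAt ℝ b x)
    (ha0 : a x = 0) (hb0 : b x = 0) :
    HasFDerivAt (fun y => a y * b y) (0 : E →L[ℝ] Matrix (Fin m) (Fin p) ℝ) x := by
  have h := mulCLM.hasFDerivAt_of_bilinear ha.hasFDerivAt hb.hasFDerivAt
  simp only [ha0, hb0, map_zero, add_zero] at h
  exact h

theorem contDiffAt_inv {A : Matrix (Fin k) (Fin k) ℝ} (hA : IsUnit A.det) :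
    ContDiffAt ℝ r (fun B : Matrix (Fin k) (Fin k) ℝ => B⁻¹) A := by
  let := Matrix.frobeniusNormedRing (m := Fin k) (α := ℝ)
  let := Matrix.frobeniusNormedAlgebra (m := Fin k) (α := ℝ) (R := ℝ)
  obtain ⟨u, rfl⟩ := (isUnit_iff_isUnit_det A).2 hA
  simpa only [nonsing_inv_eq_ringInverse] using contDiffAt_ringInverse ℝ (n := r) u

variable {X : Matrix (Fin m) (Fin n) ℝ} {A : Matrix (Fin k) (Fin m) ℝ}
  {B : Matrix (Fin n) (Fin k) ℝ}

theorem contDiffAt_mul_mul (A : Matrix (Fin p) (Fin m) ℝ) (B : Matrix (Fin n) (Fin q) ℝ) :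
    ContDiffAt ℝ r (fun Y : Matrix (Fin m) (Fin n) ℝ => A * Y * B) X :=
  contDiffAt_mul (contDiffAt_mul contDiffAt_const contDiffAt_id) contDiffAt_const

theorem eventually_isUnit_det (h : IsUnit (A * X * B).det) :
    ∀ᶠ Y in 𝓝 X, IsUnit (A * Y * B).det := by
  simp only [isUnit_iff_ne_zero] at h ⊢
  have hcont : Continuous fun Y : Matrix (Fin m) (Fin n) ℝ => (A * Y * B).det := by fun_prop
  exact hcont.continuousAt.eventually_ne h

theorem contDiffAt_inv_mul_mul (h : IsUnit (A * X * B).det) :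
    ContDiffAt ℝ r (fun Y : Matrix (Fin m) (Fin n) ℝ => (A * Y * B)⁻¹) X :=
  (contDiffAt_inv h).comp X (contDiffAt_mul_mul A B)

theorem eventually_mem_fixedRank (h : IsUnit (A * X * B).det) :
    ∀ᶠ Y in 𝓝 X, Y.rank ≤ k → Y ∈ fixedRank m n k := by
  filter_upwards [eventually_isUnit_det h] with Y hY hr
    using le_antisymm hr (by simpa using card_le_rank_of_isUnit_det hY)

theorem isLocalRetraction_fixedRank (h : IsUnit (A * X * B).det) (hr : X.rank = k) :
    IsLocalRetraction (fixedRank m n k)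
      (fun Y : Matrix (Fin m) (Fin n) ℝ => Y * B * (A * Y * B)⁻¹ * (A * Y)) X where
  base_mem := hr
  contDiffAt := contDiffAt_mul (contDiffAt_mul (contDiffAt_mul contDiffAt_id contDiffAt_const)
    (contDiffAt_inv_mul_mul h)) (contDiffAt_mul contDiffAt_const contDiffAt_id)
  eventually_mem := by
    filter_upwards [eventually_isUnit_det h] with Y hY
    have hdet : IsUnit (A * (Y * B * (A * Y * B)⁻¹ * (A * Y)) * B).det := by
      convert hY using 2
      calc A * (Y * B * (A * Y * B)⁻¹ * (A * Y)) * B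
          = A * Y * B * (A * Y * B)⁻¹ * (A * Y * B) := by simp only [Matrix.mul_assoc]
        _ = A * Y * B := nonsing_inv_mul_cancel_right _ _ hY
    exact le_antisymm ((rank_mul_le_right _ _).trans (by simpa using (A * Y).rank_le_height))
      (by simpa using card_le_rank_of_isUnit_det hdet)
  eventually_eq_self := by
    filter_upwards [eventually_isUnit_det h] with Y hY hYr
      using mul_mul_inv_mul_eq_self_of_rank_le hY (by simpa using hYr.le)

theorem mul_mul_eq_zero_of_mem_tangentSpaceAt (h : IsUnit (A * X * B).det) (hr : X.rank = k)
    {L : Matrix (Fin p) (Fin m) ℝ} {R : Matrix (Fin n) (Fin q) ℝ} (hL : L * X = 0)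
    (hR : X * R = 0) {ζ : Matrix (Fin m) (Fin n) ℝ}
    (hζ : ζ ∈ tangentSpaceAt (fixedRank m n k) X) : L * ζ * R = 0 := by
  set K := mulCLM.flip R ∘L mulCLM L
  have hfactor : ∀ᶠ Y in 𝓝[fixedRank m n k] X,
      K Y = (L * Y * B * (A * Y * B)⁻¹) * (A * Y * R) := by
    filter_upwards [self_mem_nhdsWithin,
      (eventually_isUnit_det h).filter_mono nhdsWithin_le_nhds] with Y hYr hY
    have hcross := mul_mul_inv_mul_eq_self_of_rank_le hY (by simpa using hYr.le)
    calc K Y = L * (Y * B * (A * Y * B)⁻¹ * (A * Y)) * R := by rw [hcross]; rfl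
      _ = _ := by simp only [Matrix.mul_assoc]
  have hzero : HasFDerivAt (fun Y => (L * Y * B * (A * Y * B)⁻¹) * (A * Y * R))
      (0 : Matrix (Fin m) (Fin n) ℝ →L[ℝ] Matrix (Fin p) (Fin q) ℝ) X :=
    hasFDerivAt_mul_zero
      ((contDiffAt_mul (contDiffAt_mul_mul L B) (contDiffAt_inv_mul_mul h)).differentiableAt
        one_ne_zero)
      ((contDiffAt_mul_mul A R).differentiableAt one_ne_zero)
      (by simp [hL]) (by simp [Matrix.mul_assoc, hR])
  have hwithin := hzero.hasFDerivWithinAt.congr_of_eventuallyEq hfactor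
    (hfactor.self_of_nhdsWithin hr)
  exact LinearMap.eqOn_span (f := K.toLinearMap) (g := 0)
    (K.hasFDerivWithinAt.unique_on hwithin) hζ

end MatrixCalculus

section Projections
open Matrix

variable {m n k : ℕ} {X : Matrix (Fin m) (Fin n) ℝ} {U : Matrix (Fin m) (Fin k) ℝ}
  {V : Matrix (Fin n) (Fin k) ℝ}

theorem isSymmetricProjection_projV (hV : Vᵀ * V = 1) :
    (projV m V : Matrix (Fin m) (Fin n) ℝ →ₗ[ℝ] _).IsSymmetricProjection where
  isIdempotentElem := LinearMap.ext fun Z => by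
    change Z * (V * Vᵀ) * (V * Vᵀ) = Z * (V * Vᵀ)
    rw [Matrix.mul_assoc, Matrix.mul_assoc V, ← Matrix.mul_assoc Vᵀ, hV, Matrix.one_mul]
  isSymmetric Z Y := by
    change ((Z * (V * Vᵀ))ᵀ * Y).trace = (Zᵀ * (Y * (V * Vᵀ))).trace
    rw [transpose_mul, transpose_mul, transpose_transpose, Matrix.mul_assoc, trace_mul_comm,
      Matrix.mul_assoc]

theorem isSymmetricProjection_projU (hU : Uᵀ * U = 1) :
    (projU n U : Matrix (Fin m) (Fin n) ℝ →ₗ[ℝ] _).IsSymmetricProjection where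
  isIdempotentElem := LinearMap.ext fun Z => by
    change U * Uᵀ * (U * Uᵀ * Z) = U * Uᵀ * Z
    rw [← Matrix.mul_assoc, Matrix.mul_assoc U, ← Matrix.mul_assoc Uᵀ, hU, Matrix.one_mul]
  isSymmetric Z Y := by
    change ((U * Uᵀ * Z)ᵀ * Y).trace = (Zᵀ * (U * Uᵀ * Y)).trace
    rw [transpose_mul, transpose_mul, transpose_transpose, Matrix.mul_assoc]

theorem starProjection_range_projV (hV : Vᵀ * V = 1) :
    (projV m V).range.starProjection = projV m V :=
  (isStarProjection_iff_eq_starProjection_range.1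
    (ContinuousLinearMap.isStarProjection_iff_isSymmetricProjection.2
      (isSymmetricProjection_projV hV))).snd.symm

theorem starProjection_range_projU (hU : Uᵀ * U = 1) :
    (projU n U).range.starProjection = projU n U :=
  (isStarProjection_iff_eq_starProjection_range.1
    (ContinuousLinearMap.isStarProjection_iff_isSymmetricProjection.2
      (isSymmetricProjection_projU hU))).snd.symm

theorem mem_range_projV_iff_mul_eq (hV : Vᵀ * V = 1) :
    X ∈ (projV m V).range ↔ X * (V * Vᵀ) = X := by
  rw [← Submodule.starProjection_eq_self_iff, starProjection_range_projV hV]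
  rfl

theorem mem_range_projU_iff_mul_eq (hU : Uᵀ * U = 1) :
    X ∈ (projU n U).range ↔ U * Uᵀ * X = X := by
  rw [← Submodule.starProjection_eq_self_iff, starProjection_range_projU hU]
  rfl

theorem mem_range_projV_iff (hV : Vᵀ * V = 1) :
    X ∈ (projV m V).range ↔ ∃ L : Matrix (Fin m) (Fin k) ℝ, X = L * Vᵀ := by
  rw [mem_range_projV_iff_mul_eq hV]
  refine ⟨fun h => ⟨X * V, by rw [Matrix.mul_assoc, h]⟩, ?_⟩
  rintro ⟨L, rfl⟩
  rw [Matrix.mul_assoc, ← Matrix.mul_assoc Vᵀ, hV, Matrix.one_mul]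

theorem mem_range_projU_iff (hU : Uᵀ * U = 1) :
    X ∈ (projU n U).range ↔ ∃ R : Matrix (Fin k) (Fin n) ℝ, X = U * R := by
  rw [mem_range_projU_iff_mul_eq hU]
  refine ⟨fun h => ⟨Uᵀ * X, by rw [← Matrix.mul_assoc, h]⟩, ?_⟩
  rintro ⟨R, rfl⟩
  rw [Matrix.mul_assoc, ← Matrix.mul_assoc Uᵀ, hU, Matrix.one_mul]

theorem rank_le_of_mem_range_projV (h : X ∈ (projV m V).range) : X.rank ≤ k := by
  obtain ⟨Z, hZ⟩ := h
  rw [← hZ]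
  exact (rank_mul_le_right Z (V * Vᵀ)).trans ((rank_mul_le_left _ _).trans V.rank_le_width)

theorem rank_le_of_mem_range_projU (h : X ∈ (projU n U).range) : X.rank ≤ k := by
  obtain ⟨Z, hZ⟩ := h
  rw [← hZ]
  exact (rank_mul_le_left (U * Uᵀ) Z).trans ((rank_mul_le_left _ _).trans U.rank_le_width)

section Tangent

variable {A : Matrix (Fin k) (Fin m) ℝ} {B : Matrix (Fin n) (Fin k) ℝ}
  {ζ : Matrix (Fin m) (Fin n) ℝ}

theorem sub_mul_sub_eq_zero_of_mem_tangentSpaceAt (h : IsUnit (A * X * B).det) (hr : X.rank = k)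
    (hU : U * Uᵀ * X = X) (hV : X * (V * Vᵀ) = X)
    (hζ : ζ ∈ tangentSpaceAt (fixedRank m n k) X) :
    (1 - U * Uᵀ) * ζ * (1 - V * Vᵀ) = 0 :=
  mul_mul_eq_zero_of_mem_tangentSpaceAt h hr (by rw [Matrix.sub_mul, Matrix.one_mul, hU, sub_self])
    (by rw [Matrix.mul_sub, Matrix.mul_one, hV, sub_self]) hζ

theorem sub_projU_mem_range_projV (h : IsUnit (A * X * B).det) (hr : X.rank = k)
    (hU : U * Uᵀ * X = X) (hV : X * (V * Vᵀ) = X)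
    (hζ : ζ ∈ tangentSpaceAt (fixedRank m n k) X) : ζ - projU n U ζ ∈ (projV m V).range := by
  refine ⟨ζ - projU n U ζ, (sub_eq_zero.1 ?_).symm⟩
  have hblock := sub_mul_sub_eq_zero_of_mem_tangentSpaceAt h hr hU hV hζ
  rwa [Matrix.mul_sub, Matrix.sub_mul, Matrix.one_mul, Matrix.mul_one] at hblock

theorem sub_projV_mem_range_projU (h : IsUnit (A * X * B).det) (hr : X.rank = k)
    (hU : U * Uᵀ * X = X) (hV : X * (V * Vᵀ) = X)
    (hζ : ζ ∈ tangentSpaceAt (fixedRank m n k) X) : ζ - projV m V ζ ∈ (projU n U).range := by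
  refine ⟨ζ - projV m V ζ, (sub_eq_zero.1 ?_).symm⟩
  have hblock := sub_mul_sub_eq_zero_of_mem_tangentSpaceAt h hr hU hV hζ
  rwa [Matrix.mul_assoc, Matrix.sub_mul, Matrix.one_mul, Matrix.mul_sub, Matrix.mul_one] at hblock

end Tangent

theorem continuousAt_transpose_mul_inv_mul {C : Matrix (Fin k) (Fin n) ℝ}
    (h : IsUnit (C * Cᵀ).det) :
    ContinuousAt (fun D : Matrix (Fin k) (Fin n) ℝ => Dᵀ * (D * Dᵀ)⁻¹ * D) C := by
  have htranspose : ContDiff ℝ 0 fun D : Matrix (Fin k) (Fin n) ℝ => Dᵀ :=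
    contDiff_zero.2 (by fun_prop)
  have hgram : ContDiffAt ℝ 0 (fun D : Matrix (Fin k) (Fin n) ℝ => D * Dᵀ) C :=
    contDiffAt_mul contDiffAt_id htranspose.contDiffAt
  exact (contDiffAt_mul (contDiffAt_mul htranspose.contDiffAt ((contDiffAt_inv h).comp C hgram))
    contDiffAt_id).continuousAt

theorem tendsto_mul_transpose {ι : Type*} {l : Filter ι} {D : ι → Matrix (Fin k) (Fin n) ℝ}
    {C : Matrix (Fin k) (Fin n) ℝ} {Q : ι → Matrix (Fin n) (Fin k) ℝ} (hD : Tendsto D l (𝓝 C))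
    (hQ : ∀ i, (Q i)ᵀ * Q i = 1) (hDQ : ∀ i, D i * (Q i * (Q i)ᵀ) = D i) (hV : Vᵀ * V = 1)
    (hCV : C * (V * Vᵀ) = C) (h : IsUnit (C * V).det) :
    Tendsto (fun i => Q i * (Q i)ᵀ) l (𝓝 (V * Vᵀ)) := by
  have hgram : IsUnit (C * Cᵀ).det := by
    have hfactor : C * Cᵀ = C * V * (C * V)ᵀ := by
      nth_rewrite 1 [← hCV]
      simp only [transpose_mul, Matrix.mul_assoc]
    rw [hfactor, det_mul, det_transpose]
    exact h.mul h
  have hunit : ∀ᶠ i in l, IsUnit (D i * (D i)ᵀ).det := by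
    simp only [isUnit_iff_ne_zero] at hgram ⊢
    have hcont : Continuous fun B : Matrix (Fin k) (Fin n) ℝ => (B * Bᵀ).det := by fun_prop
    exact hD.eventually (hcont.continuousAt.eventually_ne hgram)
  have hlim := (continuousAt_transpose_mul_inv_mul hgram).tendsto.comp hD
  rw [mul_transpose_eq_of_mul_mul_transpose_eq hV hCV hgram] at hlim
  refine hlim.congr' ?_
  filter_upwards [hunit] with i hi using mul_transpose_eq_of_mul_mul_transpose_eq (hQ i) (hDQ i) hi

theorem tendsto_projV {ι : Type*} {l : Filter ι} {Q : ι → Matrix (Fin n) (Fin k) ℝ}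
    (hQ : Tendsto (fun i => Q i * (Q i)ᵀ) l (𝓝 (V * Vᵀ))) :
    Tendsto (fun i => projV m (Q i)) l (𝓝 (projV m V)) :=
  ((mulCLM (m := m) (n := n) (p := n)).flip.continuous.tendsto _).comp hQ

theorem tendsto_projU {ι : Type*} {l : Filter ι} {Q : ι → Matrix (Fin m) (Fin k) ℝ}
    (hQ : Tendsto (fun i => Q i * (Q i)ᵀ) l (𝓝 (U * Uᵀ))) :
    Tendsto (fun i => projU n (Q i)) l (𝓝 (projU n U)) :=
  ((mulCLM (m := m) (n := m) (p := n)).continuous.tendsto _).comp hQ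

end Projections

section OrthonormalBases
open Matrix

variable {m n k : ℕ} {X : Matrix (Fin m) (Fin n) ℝ} {U : Matrix (Fin m) (Fin k) ℝ}
  {V : Matrix (Fin n) (Fin k) ℝ}

/-- The columns of `U` and of `V` are orthonormal bases of the column space and of the row space
of `X`, as in a reduced singular value decomposition. The inclusions of the two spaces are stated
through the projections, and `Uᵀ X V` is the `k × k` matrix of `X` in the two bases. -/
structure IsOrthonormalBasisPair (X : Matrix (Fin m) (Fin n) ℝ) (U : Matrix (Fin m) (Fin k) ℝ)
    (V : Matrix (Fin n) (Fin k) ℝ) : Prop where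
  left_orthonormal : Uᵀ * U = 1
  right_orthonormal : Vᵀ * V = 1
  mul_transpose_mul : U * Uᵀ * X = X
  mul_mul_transpose : X * (V * Vᵀ) = X
  isUnit_det : IsUnit (Uᵀ * X * V).det

theorem transpose_mul_mul_transpose_eq (h : U * Uᵀ * X = X) : Xᵀ * (U * Uᵀ) = Xᵀ := by
  simpa only [transpose_mul, transpose_transpose] using congrArg Matrix.transpose h

theorem mul_transpose_mul_transpose_eq (h : X * (V * Vᵀ) = X) : V * Vᵀ * Xᵀ = Xᵀ := by
  simpa only [transpose_mul, transpose_transpose] using congrArg Matrix.transpose h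

namespace IsOrthonormalBasisPair

theorem of_eq_mul {S : Matrix (Fin k) (Fin k) ℝ} (hU : Uᵀ * U = 1) (hV : Vᵀ * V = 1)
    (hX : X = U * S * Vᵀ) (hr : X.rank = k) : IsOrthonormalBasisPair X U V where
  left_orthonormal := hU
  right_orthonormal := hV
  mul_transpose_mul :=
    (mem_range_projU_iff_mul_eq hU).1 ((mem_range_projU_iff hU).2 ⟨S * Vᵀ, by
      rw [hX, Matrix.mul_assoc]⟩)
  mul_mul_transpose := (mem_range_projV_iff_mul_eq hV).1 ((mem_range_projV_iff hV).2 ⟨U * S, hX⟩)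
  isUnit_det := by
    have hS : Uᵀ * X * V = S := by
      rw [hX, Matrix.mul_assoc U, ← Matrix.mul_assoc Uᵀ, hU, Matrix.one_mul, Matrix.mul_assoc, hV,
        Matrix.mul_one]
    rw [hS]
    refine isUnit_det_of_card_le_rank ?_
    refine (Fintype.card_fin k).trans_le (hr.symm.trans_le ?_)
    rw [hX]
    exact (rank_mul_le_left _ _).trans (rank_mul_le_right _ _)

theorem transpose (h : IsOrthonormalBasisPair X U V) : IsOrthonormalBasisPair Xᵀ V U where
  left_orthonormal := h.right_orthonormal
  right_orthonormal := h.left_orthonormal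
  mul_transpose_mul := mul_transpose_mul_transpose_eq h.mul_mul_transpose
  mul_mul_transpose := transpose_mul_mul_transpose_eq h.mul_transpose_mul
  isUnit_det := by
    rw [← det_transpose]
    simpa only [transpose_mul, transpose_transpose, Matrix.mul_assoc] using h.isUnit_det

theorem mem_range_projV (h : IsOrthonormalBasisPair X U V) : X ∈ (projV m V).range :=
  (mem_range_projV_iff_mul_eq h.right_orthonormal).2 h.mul_mul_transpose

theorem mem_range_projU (h : IsOrthonormalBasisPair X U V) : X ∈ (projU n U).range :=
  (mem_range_projU_iff_mul_eq h.left_orthonormal).2 h.mul_transpose_mul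

theorem rank_eq (h : IsOrthonormalBasisPair X U V) : X.rank = k :=
  le_antisymm (rank_le_of_mem_range_projV h.mem_range_projV)
    (by simpa using card_le_rank_of_isUnit_det h.isUnit_det)

theorem eventually_add_smul_mem_fixedRank (h : IsOrthonormalBasisPair X U V) :
    ∀ᶠ t : ℝ in 𝓝 0, X + t • (U * Vᵀ) ∈ fixedRank m n k := by
  have hline : Tendsto (fun t : ℝ => X + t • (U * Vᵀ)) (𝓝 0) (𝓝 X) :=
    Continuous.tendsto' (by fun_prop) _ _ (by simp)
  filter_upwards [hline.eventually (eventually_mem_fixedRank h.isUnit_det)] with t ht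
  exact ht (rank_le_of_mem_range_projV (Submodule.add_mem _ h.mem_range_projV
    (Submodule.smul_mem _ t ((mem_range_projV_iff h.right_orthonormal).2 ⟨U, rfl⟩))))

theorem mul_transpose_ne_zero (h : IsOrthonormalBasisPair X U V) (hk : 0 < k) :
    U * Vᵀ ≠ 0 := fun hzero => by
  have : Nonempty (Fin k) := ⟨⟨0, hk⟩⟩
  refine one_ne_zero (α := Matrix (Fin k) (Fin k) ℝ) ?_
  calc (1 : Matrix (Fin k) (Fin k) ℝ) = Uᵀ * U * (Vᵀ * V) := by
        rw [h.left_orthonormal, h.right_orthonormal, Matrix.one_mul]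
    _ = Uᵀ * (U * Vᵀ) * V := by simp only [Matrix.mul_assoc]
    _ = 0 := by rw [hzero, Matrix.mul_zero, Matrix.zero_mul]

theorem nontrivial_tangentSpaceAt (h : IsOrthonormalBasisPair X U V) (hk : 0 < k) :
    Nontrivial (tangentSpaceAt (fixedRank m n k) X) :=
  Submodule.nontrivial_iff_ne_bot.2 ((Submodule.ne_bot_iff _).2 ⟨U * Vᵀ,
    mem_tangentSpaceAt_of_add_smul_mem h.eventually_add_smul_mem_fixedRank,
    h.mul_transpose_ne_zero hk⟩)

theorem le_projectedHessianNorm (h : IsOrthonormalBasisPair X U V) (hk : 0 < k)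
    {f : Matrix (Fin m) (Fin n) ℝ → ℝ}
    {ρ : Matrix (Fin m) (Fin n) ℝ → Matrix (Fin m) (Fin n) ℝ} {l : ℝ}
    (hX : IsCoerciveCriticalPoint (fixedRank m n k) ρ f X l) :
    l ≤ projectedHessianNorm f U V X := by
  refine hX.le_of_line_mem (h.mul_transpose_ne_zero hk) h.eventually_add_smul_mem_fixedRank ?_
  have hfix : projV m V (U * Vᵀ) = U * Vᵀ :=
    (mem_range_projV_iff_mul_eq h.right_orthonormal).1
      ((mem_range_projV_iff h.right_orthonormal).2 ⟨U, rfl⟩)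
  have hle := fderiv_fderiv_apply_le_opNorm hX.contDiffAt_fun
    (isSymmetricProjection_projV (m := m) h.right_orthonormal).isSymmetric (U * Vᵀ)
  rw [hfix] at hle
  exact hle.trans (mul_le_mul_of_nonneg_right (le_max_left _ _) (sq_nonneg _))

end IsOrthonormalBasisPair
end OrthonormalBases

section AlternatingSubspaces
open Matrix

variable {m n k : ℕ} {W : ℕ → Submodule ℝ (Matrix (Fin m) (Fin n) ℝ)}
  {X : Matrix (Fin m) (Fin n) ℝ} {U : Matrix (Fin m) (Fin k) ℝ} {V : Matrix (Fin n) (Fin k) ℝ}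
  {ι : Type*} {l : Filter ι} {φ : ι → ℕ} {Y : ι → Matrix (Fin m) (Fin n) ℝ}

/-- The subspaces over which alternating least squares minimizes: for `j` even, `W j` consists of
the matrices whose row space lies in a fixed `k`-dimensional space, and for `j` odd, of those whose
column space does. -/
structure IsAlternating (k : ℕ) (W : ℕ → Submodule ℝ (Matrix (Fin m) (Fin n) ℝ)) : Prop where
  even : ∀ ⦃j⦄, Even j → ∃ Q : Matrix (Fin n) (Fin k) ℝ, Qᵀ * Q = 1 ∧ W j = (projV m Q).range
  odd : ∀ ⦃j⦄, Odd j → ∃ Q : Matrix (Fin m) (Fin k) ℝ, Qᵀ * Q = 1 ∧ W j = (projU n Q).range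

namespace IsAlternating

theorem rank_le (hW : IsAlternating k W) {j : ℕ} (hX : X ∈ W j) : X.rank ≤ k := by
  obtain hj | hj := j.even_or_odd
  · obtain ⟨Q, -, hQ⟩ := hW.even hj
    exact rank_le_of_mem_range_projV (hQ ▸ hX)
  · obtain ⟨Q, -, hQ⟩ := hW.odd hj
    exact rank_le_of_mem_range_projU (hQ ▸ hX)

theorem sub_starProjection_mem (hW : IsAlternating k W)
    {A : Matrix (Fin k) (Fin m) ℝ} {B : Matrix (Fin n) (Fin k) ℝ} (h : IsUnit (A * X * B).det)
    {j : ℕ} (hX : X ∈ W j) (hX' : X ∈ W (j + 1))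
    {ζ : Matrix (Fin m) (Fin n) ℝ} (hζ : ζ ∈ tangentSpaceAt (fixedRank m n k) X) :
    ζ - (W (j + 1)).starProjection ζ ∈ W j := by
  have hr : X.rank = k :=
    le_antisymm (hW.rank_le hX) (by simpa using card_le_rank_of_isUnit_det h)
  obtain hj | hj := j.even_or_odd
  · obtain ⟨Q, hQ, hWQ⟩ := hW.even hj
    obtain ⟨P, hP, hWP⟩ := hW.odd hj.add_one
    rw [hWQ, mem_range_projV_iff_mul_eq hQ] at hX
    rw [hWP, mem_range_projU_iff_mul_eq hP] at hX'
    simp only [hWQ, hWP, starProjection_range_projU hP]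
    exact sub_projU_mem_range_projV h hr hX' hX hζ
  · obtain ⟨P, hP, hWP⟩ := hW.odd hj
    obtain ⟨Q, hQ, hWQ⟩ := hW.even hj.add_one
    rw [hWP, mem_range_projU_iff_mul_eq hP] at hX
    rw [hWQ, mem_range_projV_iff_mul_eq hQ] at hX'
    simp only [hWQ, hWP, starProjection_range_projV hQ]
    exact sub_projV_mem_range_projU h hr hX hX' hζ

theorem tendsto_starProjection_of_even (hW : IsAlternating k W)
    (h : IsOrthonormalBasisPair X U V) (hY : Tendsto Y l (𝓝 X)) (hφ : ∀ i, Even (φ i))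
    (hmem : ∀ i, Y i ∈ W (φ i)) :
    Tendsto (fun i => (W (φ i)).starProjection) l (𝓝 (projV m V)) := by
  choose Q hQ hWQ using fun i => hW.even (hφ i)
  have hcont : Continuous fun Z : Matrix (Fin m) (Fin n) ℝ => Uᵀ * Z := by fun_prop
  have hlim : Tendsto (fun i => Q i * (Q i)ᵀ) l (𝓝 (V * Vᵀ)) := by
    refine tendsto_mul_transpose ((hcont.tendsto X).comp hY) hQ (fun i => ?_) h.right_orthonormal ?_
      h.isUnit_det
    · rw [Function.comp_apply, Matrix.mul_assoc,
        (mem_range_projV_iff_mul_eq (hQ i)).1 (hWQ i ▸ hmem i)]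
    · rw [Matrix.mul_assoc, h.mul_mul_transpose]
  simpa only [hWQ, starProjection_range_projV (hQ _)] using tendsto_projV hlim

theorem tendsto_starProjection_of_odd (hW : IsAlternating k W) (h : IsOrthonormalBasisPair X U V)
    (hY : Tendsto Y l (𝓝 X)) (hφ : ∀ i, Odd (φ i)) (hmem : ∀ i, Y i ∈ W (φ i)) :
    Tendsto (fun i => (W (φ i)).starProjection) l (𝓝 (projU n U)) := by
  choose Q hQ hWQ using fun i => hW.odd (hφ i)
  have hcont : Continuous fun Z : Matrix (Fin m) (Fin n) ℝ => Vᵀ * Zᵀ := by fun_prop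
  have hlim : Tendsto (fun i => Q i * (Q i)ᵀ) l (𝓝 (U * Uᵀ)) := by
    refine tendsto_mul_transpose ((hcont.tendsto X).comp hY) hQ (fun i => ?_) h.left_orthonormal ?_
      h.transpose.isUnit_det
    · rw [Function.comp_apply, Matrix.mul_assoc, transpose_mul_mul_transpose_eq
        ((mem_range_projU_iff_mul_eq (hQ i)).1 (hWQ i ▸ hmem i))]
    · rw [Matrix.mul_assoc, h.transpose.mul_mul_transpose]
  simpa only [hWQ, starProjection_range_projU (hQ _)] using tendsto_projU hlim

theorem eventually_fderiv_fderiv_apply_le (hW : IsAlternating k W)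
    (h : IsOrthonormalBasisPair X U V) {z : ℕ → Matrix (Fin m) (Fin n) ℝ}
    (hz : Tendsto z atTop (𝓝 X)) (hmem : ∀ j, z j ∈ W j) {f : Matrix (Fin m) (Fin n) ℝ → ℝ}
    (hf : ContDiffAt ℝ 2 f X) {L : ℝ} (hL : projectedHessianNorm f U V X < L) :
    ∀ᶠ j in atTop, ∀ w ∈ W j, fderiv ℝ (fderiv ℝ f) X w w ≤ L * ‖w‖ ^ 2 := by
  have heven : Tendsto (fun i : ℕ => 2 * i) atTop atTop := tendsto_id.const_mul_atTop' two_pos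
  have hodd := (tendsto_add_atTop_nat 1).comp heven
  refine eventually_of_even_of_odd ?_ ?_
  · exact eventually_fderiv_fderiv_le_of_tendsto_starProjection
      (hW.tendsto_starProjection_of_even h (hz.comp heven) even_two_mul fun _ => hmem _)
      (isSymmetricProjection_projV h.right_orthonormal).isSymmetric hf (max_lt_iff.1 hL).1
  · exact eventually_fderiv_fderiv_le_of_tendsto_starProjection
      (hW.tendsto_starProjection_of_odd h (hz.comp hodd) (φ := fun i => 2 * i + 1)
        odd_two_mul_add_one fun _ => hmem _)
      (isSymmetricProjection_projU h.left_orthonormal).isSymmetric hf (max_lt_iff.1 hL).2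

end IsAlternating
end AlternatingSubspaces

section AlternatingLeastSquares
open Matrix

variable {m n k : ℕ} {f : Matrix (Fin m) (Fin n) ℝ → ℝ}
  {W : ℕ → Submodule ℝ (Matrix (Fin m) (Fin n) ℝ)} {z : ℕ → Matrix (Fin m) (Fin n) ℝ}
  {X : Matrix (Fin m) (Fin n) ℝ} {U : Matrix (Fin m) (Fin k) ℝ} {V : Matrix (Fin n) (Fin k) ℝ}

theorem IsQRFactor.mul_transpose_mem_range_projV {Q : Matrix (Fin n) (Fin k) ℝ}
    (hQ : IsQRFactor V Q) (A : Matrix (Fin m) (Fin k) ℝ) : A * Vᵀ ∈ (projV m Q).range := by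
  obtain ⟨horth, R, -, rfl⟩ := hQ
  exact (mem_range_projV_iff horth).2 ⟨A * Rᵀ, by rw [transpose_mul, Matrix.mul_assoc]⟩

theorem IsQRFactor.mul_mem_range_projU {Q : Matrix (Fin m) (Fin k) ℝ} (hQ : IsQRFactor U Q)
    (B : Matrix (Fin k) (Fin n) ℝ) : U * B ∈ (projU n Q).range := by
  obtain ⟨horth, R, -, rfl⟩ := hQ
  exact (mem_range_projU_iff horth).2 ⟨R * B, Matrix.mul_assoc Q R B⟩

theorem IsALS.exists_isSubspaceMinimization {U : ℕ → Matrix (Fin m) (Fin k) ℝ}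
    {V : ℕ → Matrix (Fin n) (Fin k) ℝ} (h : IsALS f U V) :
    ∃ W z, IsAlternating k W ∧ IsSubspaceMinimization f W z ∧ ∀ i, z (2 * i) = U i * (V i)ᵀ := by
  choose Q A hQ hA hU hV using h
  obtain ⟨W, hWeven, hWodd⟩ := exists_interleave
    (fun i => (projV m (Q i)).range) (fun i => (projU n (U (i + 1))).range)
  obtain ⟨z, hzeven, hzodd⟩ := exists_interleave (fun i => U i * (V i)ᵀ) (fun i => A i * (Q i)ᵀ)
  have hzsucc : ∀ i, z (2 * i + 1 + 1) = U (i + 1) * (V (i + 1))ᵀ := fun i => hzeven (i + 1)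
  refine ⟨W, z, ⟨fun j hj => ?_, fun j hj => ?_⟩, ⟨fun j => ?_, fun j => ?_, fun j w hw => ?_⟩,
    hzeven⟩
  · obtain ⟨i, rfl⟩ := hj.exists_two_nsmul
    exact ⟨Q i, (hQ i).1, hWeven i⟩
  · obtain ⟨i, rfl⟩ := hj
    exact ⟨U (i + 1), (hU i).1, hWodd i⟩
  · obtain ⟨i, rfl | rfl⟩ := j.even_or_odd'
    · rw [hWeven, hzeven]
      exact (hQ i).mul_transpose_mem_range_projV _
    · rw [hWodd, hzodd]
      exact (hU i).mul_mem_range_projU _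
  · obtain ⟨i, rfl | rfl⟩ := j.even_or_odd'
    · rw [hWeven, hzodd]
      exact (mem_range_projV_iff (hQ i).1).2 ⟨_, rfl⟩
    · rw [hWodd, hzsucc]
      exact (mem_range_projU_iff (hU i).1).2 ⟨_, rfl⟩
  · obtain ⟨i, rfl | rfl⟩ := j.even_or_odd'
    · rw [SetLike.mem_coe, hWeven, mem_range_projV_iff (hQ i).1] at hw
      obtain ⟨L, rfl⟩ := hw
      exact (hzodd i).symm ▸ hA i L
    · rw [SetLike.mem_coe, hWodd, mem_range_projU_iff (hU i).1] at hw
      obtain ⟨R, rfl⟩ := hw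
      exact (hzsucc i).symm ▸ hV i Rᵀ

theorem riemannianGradient_eq_zero_of_isMinOn (h : IsOrthonormalBasisPair X U V)
    (hf : DifferentiableAt ℝ f X) (hU : IsMinOn f (projU n U).range X)
    (hV : IsMinOn f (projV m V).range X) : riemannianGradient (fixedRank m n k) f X = 0 := by
  have hgradU := starProjection_gradient_eq_zero hf h.mem_range_projU hU
  have hgradV := starProjection_gradient_eq_zero hf h.mem_range_projV hV
  have hle := norm_riemannianGradient_le (M := fixedRank m n k) (V' := (projU n U).range) hgradV
    fun ζ hζ => by
      rw [starProjection_range_projU h.left_orthonormal]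
      exact sub_projU_mem_range_projV h.isUnit_det h.rank_eq h.mul_transpose_mul
        h.mul_mul_transpose hζ
  rw [hgradU, norm_zero] at hle
  exact norm_le_zero_iff.1 hle

theorem riemannianGradient_eq_zero_of_mapClusterPt (hW : IsAlternating k W)
    (hz : IsSubspaceMinimization f W z) (h : IsOrthonormalBasisPair X U V)
    (hf : Differentiable ℝ f) (hstep : Tendsto (fun j => z (j + 1) - z j) atTop (𝓝 0))
    (hacc : MapClusterPt X atTop fun i => z (2 * i)) :
    riemannianGradient (fixedRank m n k) f X = 0 := by
  obtain ⟨ψ, hψ, hlim⟩ := hacc.tendsto_subseq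
  have hnext : ∀ {φ : ℕ → ℕ}, Tendsto φ atTop atTop → Tendsto (fun i => z (φ i)) atTop (𝓝 X) →
      Tendsto (fun i => z (φ i + 1)) atTop (𝓝 X) := fun hφ hzφ => by
    simpa using hzφ.add (hstep.comp hφ)
  have heven : Tendsto (fun i => 2 * ψ i) atTop atTop := hψ.tendsto_atTop.const_mul_atTop' two_pos
  have hodd : Tendsto (fun i => 2 * ψ i + 1) atTop atTop := (tendsto_add_atTop_nat 1).comp heven
  have hlim₁ := hnext heven hlim
  have hlim₂ := hnext hodd hlim₁
  refine riemannianGradient_eq_zero_of_isMinOn h (hf X) ?_ ?_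
  · refine isMinOn_of_tendsto_starProjection hf.continuous (fun _ => hz.isMinOn _)
      ((hf.continuous.tendsto X).comp hlim₂) ?_
    rw [starProjection_range_projU h.left_orthonormal]
    exact hW.tendsto_starProjection_of_odd h hlim₁ (fun _ => odd_two_mul_add_one _)
      fun _ => hz.mem _
  · refine isMinOn_of_tendsto_starProjection hf.continuous (fun _ => hz.isMinOn _)
      ((hf.continuous.tendsto X).comp hlim₁) ?_
    rw [starProjection_range_projV h.right_orthonormal]
    exact hW.tendsto_starProjection_of_even h hlim (fun _ => even_two_mul _) fun _ => hz.mem _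

namespace IsAlternating

variable {ρ : Matrix (Fin m) (Fin n) ℝ → Matrix (Fin m) (Fin n) ℝ} {l : ℝ}

theorem tendsto (hW : IsAlternating k W) (hz : IsSubspaceMinimization f W z)
    (h : IsOrthonormalBasisPair X U V) (hf : Continuous f)
    (hX : IsCoerciveCriticalPoint (fixedRank m n k) ρ f X l) (hl : 0 < l)
    (hstep : Tendsto (fun j => z (j + 1) - z j) atTop (𝓝 0)) (hacc : MapClusterPt X atTop z) :
    Tendsto z atTop (𝓝 X) := by
  refine hz.tendsto_of_growth hf hstep hacc (half_pos (half_pos hl))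
    (hX.eventually_growth (half_lt_self hl)) ?_
  filter_upwards [eventually_mem_fixedRank h.isUnit_det] with Y hY ⟨j, hj⟩
    using hY (hW.rank_le (hj ▸ hz.mem j))

theorem eventually_mem_fixedRank (hW : IsAlternating k W) (h : IsOrthonormalBasisPair X U V)
    (hmem : ∀ j, z j ∈ W j) (hlim : Tendsto z atTop (𝓝 X)) :
    ∀ᶠ j in atTop, z j ∈ fixedRank m n k :=
  (hlim.eventually (LowRank.eventually_mem_fixedRank h.isUnit_det)).mono fun j hj =>
    hj (hW.rank_le (hmem j))

theorem eventually_contraction (hW : IsAlternating k W) (hz : IsSubspaceMinimization f W z)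
    (h : IsOrthonormalBasisPair X U V) (hf : Differentiable ℝ f)
    (hX : IsCoerciveCriticalPoint (fixedRank m n k) ρ f X l) (hl : 0 < l)
    (hL : 0 < projectedHessianNorm f U V X) (hlim : Tendsto z atTop (𝓝 X)) {θ : ℝ}
    (hθ : 1 - l / projectedHessianNorm f U V X < θ) :
    ∀ᶠ j in atTop, f (z (j + 1)) - f X ≤ θ * (f (z j) - f X) := by
  refine hz.eventually_contraction hf hX hl hL hlim (hW.eventually_mem_fixedRank h hz.mem hlim) ?_
    (fun L => hW.eventually_fderiv_fderiv_apply_le h hlim hz.mem hX.contDiffAt_fun) hθ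
  filter_upwards [((tendsto_add_atTop_iff_nat 1).2 hlim).eventually
    (eventually_isUnit_det h.isUnit_det)] with j hj ζ hζ
  exact hW.sub_starProjection_mem hj (hz.succ_mem j) (hz.mem _) hζ

end IsAlternating

end AlternatingLeastSquares

end LowRank

open LowRank in
theorem mainTheorem8_general {m n k : ℕ} (hk : 0 < k)
    (f : Matrix (Fin m) (Fin n) ℝ → ℝ) (hf : Differentiable ℝ f)
    (hconv : LowRank.IsStronglyConvex f)
    (U : ℕ → Matrix (Fin m) (Fin k) ℝ) (V : ℕ → Matrix (Fin n) (Fin k) ℝ)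
    (hALS : LowRank.IsALS f U V)
    (X : ℕ → Matrix (Fin m) (Fin n) ℝ) (hX : ∀ ℓ, X ℓ = U ℓ * (V ℓ).transpose)
    (Xs : Matrix (Fin m) (Fin n) ℝ) (hacc : MapClusterPt Xs atTop X) (hrank : Xs.rank = k)
    (hC2 : ContDiffAt ℝ 2 f Xs)
    (hpos : LowRank.IsPosDef (LowRank.riemannianHessian (LowRank.fixedRank m n k) f Xs))
    (Us : Matrix (Fin m) (Fin k) ℝ) (Ss : Matrix (Fin k) (Fin k) ℝ)
    (Vs : Matrix (Fin n) (Fin k) ℝ)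
    (hUs : Us.transpose * Us = 1) (hVs : Vs.transpose * Vs = 1)
    (hXs : Xs = Us * Ss * Vs.transpose) :
    Tendsto X atTop (𝓝 Xs) ∧
    LowRank.IsIsolatedLocalMinOn f (LowRank.fixedRank m n k) Xs ∧
    (∀ ℓ, f Xs ≤ f (X ℓ)) ∧
    ∃ lmin : ℝ,
      IsLeast {μ : ℝ | Module.End.HasEigenvalue
        (LowRank.riemannianHessian (LowRank.fixedRank m n k) f Xs) μ} lmin ∧
      limsup (fun ℓ : ℕ => ((‖X ℓ - Xs‖ ^ (1 / (ℓ : ℝ)) : ℝ) : EReal)) atTop ≤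
        ((1 - lmin / LowRank.projectedHessianNorm f Us Vs Xs : ℝ) : EReal) ∧
      1 - lmin / LowRank.projectedHessianNorm f Us Vs Xs < 1 ∧
      limsup (fun ℓ : ℕ => (((f (X ℓ) - f Xs) ^ (1 / (ℓ : ℝ)) : ℝ) : EReal)) atTop ≤
        (((1 - lmin / LowRank.projectedHessianNorm f Us Vs Xs) ^ 2 : ℝ) : EReal) := by
  obtain ⟨W, z, hW, hz, hzX⟩ := hALS.exists_isSubspaceMinimization
  obtain rfl : X = fun ℓ => z (2 * ℓ) := funext fun ℓ => (hX ℓ).trans (hzX ℓ).symm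
  have hbases := IsOrthonormalBasisPair.of_eq_mul hUs hVs hXs hrank
  have haccz : MapClusterPt Xs atTop z := hacc.of_comp (tendsto_id.const_mul_atTop' two_pos)
  have hstep := hz.tendsto_step hf hconv haccz
  have hcrit := riemannianGradient_eq_zero_of_mapClusterPt hW hz hbases hf hstep hacc
  have := hbases.nontrivial_tangentSpaceAt hk
  obtain ⟨lmin, hleast, hpos_lmin, hcoercive⟩ := IsCoerciveCriticalPoint.of_isPosDef
    (isLocalRetraction_fixedRank hbases.isUnit_det hrank) hC2 hcrit hpos
  have hle := hbases.le_projectedHessianNorm hk hcoercive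
  have hnorm := hpos_lmin.trans_le hle
  have hlim := hW.tendsto hz hbases hf.continuous hcoercive hpos_lmin hstep haccz
  have hvalue := hz.le_value hf.continuous haccz
  have hnonneg : ∀ j, 0 ≤ f (z j) - f Xs := fun j => sub_nonneg.2 (hvalue j)
  have hrate := fun θ => hW.eventually_contraction (θ := θ) hz hbases hf hcoercive hpos_lmin hnorm
    hlim
  have hdist := hcoercive.isBigO_sq_norm_sub hpos_lmin hlim
    (hW.eventually_mem_fixedRank hbases hz.mem hlim)
  have hroot_dist := limsup_root_norm_two_mul_le hnonneg (sub_nonneg.2 ((div_le_one hnorm).2 hle))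
    hrate hdist
  have hroot_value := limsup_root_two_mul_le hnonneg hrate
  exact ⟨hlim.comp (tendsto_id.const_mul_atTop' two_pos), hcoercive.isIsolatedLocalMinOn hpos_lmin,
    fun ℓ => hvalue _, lmin, hleast, hroot_dist, sub_lt_self 1 (div_pos hpos_lmin hnorm),
    hroot_value⟩

theorem mainTheorem8 {m n k : ℕ} (hk : 0 < k) (hkm : k < m) (hkn : k < n)
    (f : Matrix (Fin m) (Fin n) ℝ → ℝ) (lam : ℝ)
    (hsmooth : LowRank.IsSmooth lam f) (hconv : LowRank.IsStronglyConvex f)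
    (U : ℕ → Matrix (Fin m) (Fin k) ℝ) (V : ℕ → Matrix (Fin n) (Fin k) ℝ)
    (hALS : LowRank.IsALS f U V)
    (X : ℕ → Matrix (Fin m) (Fin n) ℝ) (hX : ∀ ℓ, X ℓ = U ℓ * (V ℓ).transpose)
    (Xs : Matrix (Fin m) (Fin n) ℝ) (hacc : MapClusterPt Xs atTop X) (hrank : Xs.rank = k)
    (hC2 : ContDiffAt ℝ 2 f Xs)
    (hpos : LowRank.IsPosDef (LowRank.riemannianHessian (LowRank.fixedRank m n k) f Xs))
    (Us : Matrix (Fin m) (Fin k) ℝ) (Ss : Matrix (Fin k) (Fin k) ℝ)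
    (Vs : Matrix (Fin n) (Fin k) ℝ)
    (hUs : Us.transpose * Us = 1) (hVs : Vs.transpose * Vs = 1)
    (hXs : Xs = Us * Ss * Vs.transpose) :
    Tendsto X atTop (𝓝 Xs) ∧
    LowRank.IsIsolatedLocalMinOn f (LowRank.fixedRank m n k) Xs ∧
    (∀ ℓ, f Xs ≤ f (X ℓ)) ∧
    ∃ lmin : ℝ,
      IsLeast {μ : ℝ | Module.End.HasEigenvalue
        (LowRank.riemannianHessian (LowRank.fixedRank m n k) f Xs) μ} lmin ∧
      limsup (fun ℓ : ℕ => ((‖X ℓ - Xs‖ ^ (1 / (ℓ : ℝ)) : ℝ) : EReal)) atTop ≤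
        ((1 - lmin / LowRank.projectedHessianNorm f Us Vs Xs : ℝ) : EReal) ∧
      1 - lmin / LowRank.projectedHessianNorm f Us Vs Xs < 1 ∧
      limsup (fun ℓ : ℕ => (((f (X ℓ) - f Xs) ^ (1 / (ℓ : ℝ)) : ℝ) : EReal)) atTop ≤
        (((1 - lmin / LowRank.projectedHessianNorm f Us Vs Xs) ^ 2 : ℝ) : EReal) :=
  mainTheorem8_general hk f hsmooth.2.1 hconv U V hALS X hX Xs hacc hrank hC2 hpos Us Ss Vs hUs hVs
    hXs
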